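/- Theorem 3.1 (Pitman and Yor). Let $\alpha\in(0,1)$ and $K,T,s>0$. Let $N=\sum_i\delta_{(T_i,P_i)}$ be a Poisson point process on $(0,\infty)^2$ with intensity $\mathrm{Leb}\times\mu_\alpha$, where $\mu_\alpha(u,\infty)=Ku^{-\alpha}$ for all $u>0$; that is, $N$ is the point process of jump times and jump sizes of the $\alpha$-stable subordinator $\tau_t=\sum_{T_i\le t}P_i$. Put $L_T=\inf\{t\ge 0:\tau_t>T\}$ and $A_T=T-\tau(L_T-)$, and define the point processes $$\xi(T)=\sum_{T_i<L_T}\delta_{P_i/T}+\delta_{A_T/T},\qquad \eta(s)=\sum_{T_i\le s}\delta_{P_i/\tau_s}.$$ Almost surely, both are mass-partitions, i.e. counting measures on $(0,\infty)$, finite on $(u,\infty)$ for every $u>0$, whose points add up to one. Both $\xi(T)$ and $\eta(s)$ have the standard Pitman–Yor distribution $\mathrm{PD}(\alpha,0)$, which is by definition the law of $\sum_{T^0_i\le 1}\delta_{P^0_i/\tau^0_1}$, where $N^0=\sum_i\delta_{(T^0_i,P^0_i)}$ is a Poisson point process as above with $K=1/\Gamma(1-\alpha)$ and $\tau^0_1=\sum_{T^0_i\le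 1}P^0_i$. In particular, the law does not depend on $K,T,s$, and $$\xi(T)\stackrel{d}{=}\eta(s).$$ Here laws are taken with respect to the $\sigma$-algebra on counting measures generated by the evaluations $m\mapsto m(B)$, $B$ Borel. -/

import Mathlib

open MeasureTheory ProbabilityTheory Set
open scoped ENNReal NNReal

universe u

noncomputable section

namespace PitmanYor

/-- A counting measure: an at most countable sum of unit point masses `∑ᵢ δ_{xᵢ}`
(repetitions are allowed). -/
def IsCountingMeasure {X : Type*} [MeasurableSpace X] (m : Measure X) : Prop :=
  ∃ (I : Set ℕ) (x : I → X), m = Measure.sum (fun i => Measure.dirac (x i))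

/-- The space `M_p((0,∞)²)` of counting measures on the open quadrant that are finite on the
bounded sets `(0,1/ε) × (ε,∞)`. They are regarded as measures on the plane which do not charge
the complement of the quadrant. -/
def quadrantConfigurations : Set (Measure (ℝ × ℝ)) :=
  {m | IsCountingMeasure m ∧ m (Ioi 0 ×ˢ Ioi 0)ᶜ = 0 ∧
    ∀ ε : ℝ, 0 < ε → m (Ioo 0 (1 / ε) ×ˢ Ioi ε) < ∞}

/-- The space `M_{p,1}` of (proper) mass-partitions: counting measures on `(0,∞)`, finite on
`(u,∞)` for `u > 0`, whose points add up to one. -/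
def massPartitions : Set (Measure ℝ) :=
  {m | IsCountingMeasure m ∧ m (Iic 0) = 0 ∧ (∀ u : ℝ, 0 < u → m (Ioi u) < ∞) ∧
    ∫⁻ x, ENNReal.ofReal x ∂m = 1}

/-- `N` is a Poisson point process with (σ-finite) intensity measure `ν` on the probability space
`(Ω, P)`. The space of measures carries the σ-algebra generated by the evaluations
`m ↦ m B`. -/
structure IsPoissonPointProcess {Ω X : Type*} [MeasurableSpace Ω] [MeasurableSpace X]
    (N : Ω → Measure X) (ν : Measure X) (P : Measure Ω) : Prop where
  measurable : Measurable N
  counting : ∀ᵐ ω ∂P, IsCountingMeasure (N ω)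
  poisson : ∀ B : Set X, MeasurableSet B → ν B ≠ ∞ →
    HasLaw (fun ω => N ω B)
      ((poissonMeasure (ν B).toNNReal).map (Nat.cast : ℕ → ℝ≥0∞)) P
  indep : ∀ (n : ℕ) (B : Fin n → Set X), (∀ i, MeasurableSet (B i)) →
    Pairwise (fun i j => Disjoint (B i) (B j)) → iIndepFun (fun i ω => N ω (B i)) P

/-- The Lévy measure `μ_α(du) = K α u^{-α-1} du` on `(0,∞)`, that is
`μ_α(u,∞) = K u^{-α}` for all `u > 0`. -/
def stableLevyMeasure (α K : ℝ) : Measure ℝ :=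
  (volume.restrict (Ioi 0)).withDensity (fun u => ENNReal.ofReal (K * α * u ^ (-α - 1)))

/-- `N` is the point process `∑ᵢ δ_{(Tᵢ, Pᵢ)}` of (jump times, jump sizes) of an `α`-stable
subordinator: a Poisson point process on `(0,∞)²` with intensity `Leb × μ_α`. -/
structure IsStableJumpProcess {Ω : Type*} [MeasurableSpace Ω] (α K : ℝ)
    (N : Ω → Measure (ℝ × ℝ)) (P : Measure Ω) : Prop where
  mem : ∀ᵐ ω ∂P, N ω ∈ quadrantConfigurations
  isPoisson :
    IsPoissonPointProcess N ((volume.restrict (Ioi 0)).prod (stableLevyMeasure α K)) P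

/-- The subordinator `τ_t = ∑_{Tᵢ ≤ t} Pᵢ` of a configuration `m = ∑ᵢ δ_{(Tᵢ, Pᵢ)}`. -/
def subordinator (m : Measure (ℝ × ℝ)) (t : ℝ) : ℝ≥0∞ :=
  ∫⁻ z in Iic t ×ˢ univ, ENNReal.ofReal z.2 ∂m

/-- The right continuous inverse `L_T = inf {t ≥ 0 : τ_t > T}` of the subordinator. -/
def firstPassage (m : Measure (ℝ × ℝ)) (T : ℝ) : ℝ :=
  sInf {t : ℝ | 0 ≤ t ∧ ENNReal.ofReal T < subordinator m t}

/-- The undershoot `A_T = T - τ(L_T -)` of the level `T`. -/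
def undershoot (m : Measure (ℝ × ℝ)) (T : ℝ) : ℝ :=
  T - (Function.leftLim (subordinator m) (firstPassage m T)).toReal

/-- The self-normalization `∑ᵢ δ_{xᵢ} ↦ ∑ᵢ δ_{xᵢ / ∑ⱼ xⱼ}`. -/
def selfNormalize (m : Measure ℝ) : Measure ℝ :=
  m.map (fun x => x / (∫⁻ y, ENNReal.ofReal y ∂m).toReal)

/-- `η(s)`: the self-normalization of the jumps `{Pᵢ : Tᵢ ≤ s}`. -/
def eta (s : ℝ) (m : Measure (ℝ × ℝ)) : Measure ℝ :=
  selfNormalize ((m.restrict (Iic s ×ˢ univ)).map Prod.snd)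

/-- `ξ(T) = {Pᵢ / T : Tᵢ < L_T} ∪ {A_T / T}`, as a counting measure. -/
def xi (T : ℝ) (m : Measure (ℝ × ℝ)) : Measure ℝ :=
  (m.restrict (Iio (firstPassage m T) ×ˢ univ)).map (fun z => z.2 / T)
    + Measure.dirac (undershoot m T / T)

/-- `Q` is the standard Pitman–Yor law `PD(α,0)`: the law of the self-normalized jumps up to time
`1` of an `α`-stable subordinator with `K = 1 / Γ(1-α)`. -/
def IsStandardPitmanYorLaw (α : ℝ) (Q : Measure (Measure ℝ)) : Prop :=
  ∃ (Ω : Type u) (_ : MeasurableSpace Ω) (P : Measure Ω) (N : Ω → Measure (ℝ × ℝ)),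
    IsProbabilityMeasure P ∧ IsStableJumpProcess α (1 / Real.Gamma (1 - α)) N P ∧
      HasLaw (fun ω => eta 1 (N ω)) Q P

end PitmanYor

end

/-!
Only one computation is needed, `E F(ξ(T)) = E F(η(1))` for measurable `F ≥ 0`; everything else
follows from the fact that the law of a Poisson process is determined by its intensity.

Write `J_t` for the point process of the jumps before time `t` and `τ_{t-}` for their sum. A jump
`(t, p)` *straddles* `T` if `τ_{t-} < T < τ_{t-} + p`; then `L_T = t`, and `ξ(T)` consists of the
points of `J_t / T` and of `(T - τ_{t-}) / T` (`xi_eq_of_straddles`). Hence `F(ξ(T))` is a sum over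
the jumps straddling `T`, of which there is at most one, because the jump times are distinct.

* By scaling (`lintegral_straddleTerm_eq_level_one`) the expectation of that sum does not depend on
  `T`, so it may be integrated over `T ∈ (0, 1)`.
* The Mecke formula (`IsPoissonPointProcess.mecke`) turns the sum over jumps into an integral over
  `dt μ_α(dp)`. For fixed `t` put `T = τ_{t-} + a`; integrating out `p > a` leaves
  `μ_α(a, ∞) da = α⁻¹ a μ_α(da)` (`lintegral_straddling_jump`): the part of the straddling jump
  below the level is a size-biased jump.
* The Mecke formula, read backwards, identifies the addition of a size-biased jump to `J_t` with the
  reweighting of `J_t` by its sum (`lintegral_lintegral_completion`). This leaves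
  `α⁻¹ ∫ t⁻¹ E[τ_{t-} 1{τ_{t-} < 1} F(η(t-))] dt`.
* As `J_t` has the law of `t ^ α⁻¹ J_1`, and `J_1` determines `η(1)` up to null sets, the integral
  over `t` can be computed explicitly for each configuration and is equal to `F(η(1))`
  (`lintegral_rpow_cutoff`, `lintegral_lintegral_straddleTerm`).

For `F = 1` the identity says that the expected number of straddling jumps is one, so that almost
surely there is exactly one (`ae_exists_straddles`). In particular the undershoot is almost surely
positive, which makes `ξ(T)` a mass-partition.
-/

namespace PitmanYor

/-! ### Locally finite measures and joint measurability -/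

section

variable {Ω X γ : Type*} [MeasurableSpace Ω] [MeasurableSpace X] [MeasurableSpace γ]

/-- `m` is finite on each set of a fixed exhaustion of the space by sets of finite `ν`-measure. -/
def IsLocallyFinite (ν : Measure X) [SigmaFinite ν] (m : Measure X) : Prop :=
  ∀ k, m (spanningSets ν k) < ∞

/-- A kernel of locally finite measures is a countable sum of finite kernels, although its mass on
the exhausting sets need not be bounded: on each of them it is a density times a normalized
kernel. -/
theorem isSFiniteKernel_of_isLocallyFinite {ν : Measure X} [SigmaFinite ν] (κ : Kernel γ X)
    (hfin : ∀ c, IsLocallyFinite ν (κ c)) : IsSFiniteKernel κ := by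
  set D : ℕ → Set X := disjointed (spanningSets ν) with hD
  have hDm : ∀ n, MeasurableSet (D n) := fun n =>
    MeasurableSet.disjointed (measurableSet_spanningSets ν) n
  have hDfin : ∀ c n, κ c (D n) < ∞ := fun c n =>
    (measure_mono (disjointed_subset _ n)).trans_lt (hfin c n)
  have hκD : ∀ n, Measurable fun c => κ c (D n) := fun n => κ.measurable_coe (hDm n)
  have hηm : ∀ n, Measurable fun c => (1 + κ c (D n))⁻¹ • (κ c).restrict (D n) := by
    intro n
    refine Measure.measurable_of_measurable_coe _ fun s hs => ?_
    simp only [Measure.smul_apply, smul_eq_mul, Measure.restrict_apply hs]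
    exact (measurable_const.add (hκD n)).inv.mul (κ.measurable_coe (hs.inter (hDm n)))
  let η : ℕ → Kernel γ X := fun n => ⟨fun c => (1 + κ c (D n))⁻¹ • (κ c).restrict (D n), hηm n⟩
  have hη : ∀ n, IsFiniteKernel (η n) := by
    intro n
    refine ⟨1, ENNReal.one_lt_top, fun c => ?_⟩
    change ((1 + κ c (D n))⁻¹ • (κ c).restrict (D n)) univ ≤ 1
    simp only [Measure.smul_apply, smul_eq_mul, Measure.restrict_apply_univ]
    rw [mul_comm, ← div_eq_mul_inv]
    exact ENNReal.div_le_of_le_mul (by rw [one_mul]; exact le_add_self)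
  let g : ℕ → γ → X → ℝ≥0 := fun n c _ => (1 + κ c (D n)).toNNReal
  have hg : ∀ n c z, (g n c z : ℝ≥0∞) = 1 + κ c (D n) := fun n c z =>
    ENNReal.coe_toNNReal (ENNReal.add_ne_top.2 ⟨ENNReal.one_ne_top, (hDfin c n).ne⟩)
  have hgm : ∀ n, Measurable (Function.uncurry fun c z => (g n c z : ℝ≥0∞)) := by
    intro n
    simp only [hg]
    exact (measurable_const.add (hκD n)).comp measurable_fst
  have hsum : κ = Kernel.sum fun n => Kernel.withDensity (η n) fun c z => (g n c z : ℝ≥0∞) := by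
    ext c s hs
    rw [Kernel.sum_apply' _ _ hs]
    have h1 : ∀ n, Kernel.withDensity (η n) (fun c z => (g n c z : ℝ≥0∞)) c s = κ c (s ∩ D n) := by
      intro n
      rw [Kernel.withDensity_apply' _ (hgm n)]
      simp only [hg, lintegral_const, Measure.restrict_apply_univ]
      change (1 + κ c (D n)) * ((1 + κ c (D n))⁻¹ • (κ c).restrict (D n)) s = _
      rw [Measure.smul_apply, smul_eq_mul, ← mul_assoc, ENNReal.mul_inv_cancel (by simp)
        (ENNReal.add_ne_top.2 ⟨ENNReal.one_ne_top, (hDfin c n).ne⟩), one_mul,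
        Measure.restrict_apply hs]
    simp only [h1]
    rw [← measure_iUnion (fun i j hij => ((disjoint_disjointed (spanningSets ν)) hij).mono
      inter_subset_right inter_subset_right) (fun n => hs.inter (hDm n)), ← inter_iUnion,
      iUnion_disjointed, iUnion_spanningSets, inter_univ]
  rw [hsum]
  have : ∀ n, IsSFiniteKernel (Kernel.withDensity (η n) fun c z => (g n c z : ℝ≥0∞)) :=
    fun n => by infer_instance
  exact Kernel.isSFiniteKernel_sum

/-- Joint measurability; local finiteness is needed for the kernel `m` to be s-finite. -/
theorem measurable_lintegral_of_isLocallyFinite (ν : Measure X) [SigmaFinite ν] {m : γ → Measure X}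
    (hm : Measurable m) (hfin : ∀ c, IsLocallyFinite ν (m c)) {f : γ → X → ℝ≥0∞}
    (hf : Measurable (Function.uncurry f)) : Measurable fun c => ∫⁻ z, f c z ∂(m c) := by
  let κ : Kernel γ X := ⟨m, hm⟩
  have : IsSFiniteKernel κ := isSFiniteKernel_of_isLocallyFinite (ν := ν) κ hfin
  exact Measurable.lintegral_kernel_prod_right (κ := κ) hf

theorem measurable_measure_of_isLocallyFinite (ν : Measure X) [SigmaFinite ν] {m : γ → Measure X}
    (hm : Measurable m) (hfin : ∀ c, IsLocallyFinite ν (m c)) {D : Set (γ × X)}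
    (hD : MeasurableSet D) : Measurable fun c => m c {z | (c, z) ∈ D} := by
  have := measurable_lintegral_of_isLocallyFinite ν hm hfin (f := fun c z => D.indicator 1 (c, z))
    ((measurable_const (a := (1 : ℝ≥0∞))).indicator hD)
  convert this using 2 with c
  exact (lintegral_indicator_one (measurable_prodMk_left hD)).symm

open Classical in
/-- The locally finite measures are left unchanged, all others are replaced by `0`. On the space of
all measures the evaluation of integrals need not be jointly measurable; after composition with
`truncation ν` it is. -/
noncomputable def truncation (ν : Measure X) [SigmaFinite ν] (m : Measure X) : Measure X :=
  if IsLocallyFinite ν m then m else 0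

theorem truncation_of_isLocallyFinite {ν : Measure X} [SigmaFinite ν] {m : Measure X}
    (h : IsLocallyFinite ν m) : truncation ν m = m := if_pos h

theorem isLocallyFinite_truncation (ν : Measure X) [SigmaFinite ν] (m : Measure X) :
    IsLocallyFinite ν (truncation ν m) := by
  unfold truncation
  split_ifs with h
  · exact h
  · intro k; simp

theorem measurable_truncation (ν : Measure X) [SigmaFinite ν] : Measurable (truncation ν) := by
  classical
  refine Measurable.ite ?_ measurable_id measurable_const
  have : {m : Measure X | IsLocallyFinite ν m} = ⋂ k, {m | m (spanningSets ν k) < ∞} := by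
    ext m; simp [IsLocallyFinite]
  rw [this]
  exact MeasurableSet.iInter fun k => measurableSet_lt
    (Measure.measurable_coe (measurableSet_spanningSets ν k)) measurable_const

theorem IsLocallyFinite.add_dirac {ν : Measure X} [SigmaFinite ν] {m : Measure X}
    (h : IsLocallyFinite ν m) (z : X) : IsLocallyFinite ν (m + Measure.dirac z) := fun k => by
  rw [Measure.add_apply]
  exact ENNReal.add_lt_top.2 ⟨h k, measure_lt_top _ _⟩

theorem measurable_add_dirac :
    Measurable fun p : X × Measure X => p.2 + Measure.dirac p.1 := by
  refine Measure.measurable_of_measurable_coe _ fun s hs => ?_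
  simp only [Measure.add_apply]
  exact ((Measure.measurable_coe hs).comp measurable_snd).add
    ((Measure.measurable_coe hs).comp (Measure.measurable_dirac.comp measurable_fst))

/-- The Mecke formula on a one-point space: a size-biased Poisson variable is a Poisson variable
plus one. -/
theorem lintegral_poisson_size_bias (r : ℝ≥0) {φ : ℝ≥0∞ → ℝ≥0∞} (hφ : Measurable φ) :
    ∫⁻ x, x * φ x ∂((poissonMeasure r).map (Nat.cast : ℕ → ℝ≥0∞)) =
      r * ∫⁻ x, φ (x + 1) ∂((poissonMeasure r).map (Nat.cast : ℕ → ℝ≥0∞)) := by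
  have hc : Measurable (Nat.cast : ℕ → ℝ≥0∞) := measurable_from_top
  rw [lintegral_map (by fun_prop) hc, lintegral_map (by fun_prop) hc, lintegral_countable',
    lintegral_countable', tsum_eq_zero_add' ENNReal.summable, ← ENNReal.tsum_mul_left]
  simp only [Nat.cast_zero, zero_mul, zero_add, poissonMeasure_singleton]
  refine tsum_congr fun n => ?_
  have h1 : ((n + 1 : ℕ) : ℝ≥0∞) * ENNReal.ofReal (Real.exp (-r) * r ^ (n + 1) / (n + 1).factorial)
      = r * ENNReal.ofReal (Real.exp (-r) * r ^ n / n.factorial) := by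
    rw [← ENNReal.ofReal_natCast, ← ENNReal.ofReal_coe_nnreal (p := r),
      ← ENNReal.ofReal_mul (by positivity), ← ENNReal.ofReal_mul (by positivity)]
    congr 1
    rw [Nat.factorial_succ]
    have := Nat.factorial_pos n
    push_cast
    field_simp
    ring
  push_cast at h1 ⊢
  calc
    _ = ((n : ℝ≥0∞) + 1) * ENNReal.ofReal
      (Real.exp (-r) * r ^ (n + 1) / (n + 1).factorial) * φ (n + 1) := by ring
    _ = _ := by rw [h1]; ring

end

/-! ### Poisson processes on finitely many atoms -/

section

variable {Ω X : Type*} [MeasurableSpace Ω] [MeasurableSpace X]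

theorem IsPoissonPointProcess.iIndepFun_of_disjoint {ν : Measure X} {N : Ω → Measure X}
    {P : Measure Ω} (hN : IsPoissonPointProcess N ν P) {ι : Type*} [Fintype ι] {E : ι → Set X}
    (hE : ∀ i, MeasurableSet (E i)) (hd : Pairwise fun i j => Disjoint (E i) (E j)) :
    iIndepFun (fun i ω => N ω (E i)) P := by
  let e := Fintype.equivFin ι
  have h := hN.indep _ (fun k => E (e.symm k)) (fun k => hE _)
    (fun i j hij => hd (e.symm.injective.ne hij))
  have := h.precomp e.injective
  simpa using this

theorem IsPoissonPointProcess.measurable_apply {ν : Measure X} {N : Ω → Measure X}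
    {P : Measure Ω} (hN : IsPoissonPointProcess N ν P) {B : Set X} (hB : MeasurableSet B) :
    Measurable fun ω => N ω B := (Measure.measurable_coe hB).comp hN.measurable

/-- The Mecke formula for one member of a finite disjoint family and a function of the evaluations
at the family. The other members may have infinite intensity. -/
theorem IsPoissonPointProcess.lintegral_apply_mul {ν : Measure X} {N : Ω → Measure X}
    {P : Measure Ω} [IsProbabilityMeasure P] (hN : IsPoissonPointProcess N ν P)
    {ι : Type*} [Fintype ι] [DecidableEq ι] {E : ι → Set X}
    (hE : ∀ i, MeasurableSet (E i)) (hd : Pairwise fun i j => Disjoint (E i) (E j))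
    {ψ : (ι → ℝ≥0∞) → ℝ≥0∞} (hψ : Measurable ψ) {j : ι} (hj : ν (E j) ≠ ∞) :
    ∫⁻ ω, N ω (E j) * ψ (fun i => N ω (E i)) ∂P =
      ν (E j) * ∫⁻ ω, ψ (fun i => N ω (E i) + if i = j then 1 else 0) ∂P := by
  have hm : ∀ i, Measurable fun ω => N ω (E i) := fun i => hN.measurable_apply (hE i)
  have hV : Measurable fun ω i => N ω (E i) := measurable_pi_lambda _ hm
  have hlaw := (iIndepFun_iff_map_fun_eq_pi_map (fun i => (hm i).aemeasurable)).1
    (hN.iIndepFun_of_disjoint hE hd)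
  have hψ' : Measurable fun v : ι → ℝ≥0∞ => ψ fun i => v i + if i = j then 1 else 0 := by
    fun_prop
  have h1 : Measurable fun v : ι → ℝ≥0∞ => v j * ψ v := by fun_prop
  have hp : ∀ i, IsProbabilityMeasure (P.map fun ω => N ω (E i)) := fun i =>
    Measure.isProbabilityMeasure_map (hm i).aemeasurable
  rw [← lintegral_map (f := fun v : ι → ℝ≥0∞ => v j * ψ v) h1 hV,
    ← lintegral_map (f := fun v : ι → ℝ≥0∞ => ψ fun i => v i + if i = j then 1 else 0) hψ' hV,
    ← lintegral_const_mul _ hψ', hlaw, lintegral_eq_lmarginal_univ (fun _ => 0),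
    lintegral_eq_lmarginal_univ (fun _ => 0), lmarginal_erase' _ h1 (Finset.mem_univ j),
    lmarginal_erase' _ (hψ'.const_mul _) (Finset.mem_univ j)]
  congr 1
  ext v
  rw [(hN.poisson _ (hE j) hj).map_eq]
  simp only [Function.update_self]
  have hb := lintegral_poisson_size_bias (ν (E j)).toNNReal (hψ.comp (measurable_update v (a := j)))
  simp only [Function.comp_apply] at hb
  rw [hb, lintegral_const_mul, ENNReal.coe_toNNReal hj]
  · congr 2
    ext x
    congr 1
    ext i
    by_cases h : i = j
    · subst h; simp
    · simp [h]
  · exact hψ'.comp (measurable_update v)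

/-- The membership pattern of a point with respect to a family of sets; its fibres are the atoms of
the algebra generated by the family. -/
noncomputable def membershipPattern {Y ι : Type*} (C : ι → Set Y) (z : Y) (i : ι) : Bool :=
  open Classical in decide (z ∈ C i)

theorem membershipPattern_eq_true {Y ι : Type*} {C : ι → Set Y} {z : Y} {i : ι} :
    membershipPattern C z i = true ↔ z ∈ C i := by simp [membershipPattern]

theorem measurable_membershipPattern {ι : Type*} {C : ι → Set X}
    (hC : ∀ i, MeasurableSet (C i)) : Measurable (membershipPattern C) := by
  refine measurable_pi_lambda _ fun i => measurable_to_bool ?_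
  convert hC i using 1
  ext z
  simp [membershipPattern]

theorem measurableSet_atom {ι : Type*} [Finite ι] {C : ι → Set X}
    (hC : ∀ i, MeasurableSet (C i)) (σ : ι → Bool) :
    MeasurableSet (membershipPattern C ⁻¹' {σ}) :=
  measurable_membershipPattern hC (measurableSet_singleton σ)

theorem pairwise_disjoint_atom {Y ι : Type*} (C : ι → Set Y) :
    Pairwise fun σ τ => Disjoint (membershipPattern C ⁻¹' {σ}) (membershipPattern C ⁻¹' {τ}) :=
  fun _ _ h => (disjoint_singleton.2 h).preimage _

open Classical in
theorem apply_eq_sum_atom {ι : Type*} [Fintype ι] {C : ι → Set X}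
    (hC : ∀ i, MeasurableSet (C i)) (m : Measure X) (i : ι) :
    m (C i) = ∑ σ : ι → Bool, if σ i = true then m (membershipPattern C ⁻¹' {σ}) else 0 := by
  rw [← Finset.sum_filter, ← measure_biUnion_finset
    (fun σ _ τ _ h => pairwise_disjoint_atom C h) (fun σ _ => measurableSet_atom hC σ)]
  congr 1
  ext z
  simp [← membershipPattern_eq_true (C := C)]

open Classical in
/-- The Mecke formula for functions of finitely many evaluations, at sets that may overlap; it is
reduced to the disjoint case by passing to the atoms. -/
theorem IsPoissonPointProcess.lintegral_apply_mul_comp {ν : Measure X} {N : Ω → Measure X}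
    {P : Measure Ω} [IsProbabilityMeasure P] (hN : IsPoissonPointProcess N ν P)
    {ι : Type*} [Fintype ι] {C : ι → Set X} (hC : ∀ i, MeasurableSet (C i))
    {ψ : (ι → ℝ≥0∞) → ℝ≥0∞} (hψ : Measurable ψ) {j : ι} (hj : ν (C j) ≠ ∞) :
    ∫⁻ ω, N ω (C j) * ψ (fun i => N ω (C i)) ∂P =
      ∫⁻ z in C j, ∫⁻ ω, ψ (fun i => (N ω + Measure.dirac z) (C i)) ∂P ∂ν := by
  set E : (ι → Bool) → Set X := fun σ => membershipPattern C ⁻¹' {σ} with hE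
  have hEm : ∀ σ, MeasurableSet (E σ) := measurableSet_atom hC
  have hEd : Pairwise fun σ τ => Disjoint (E σ) (E τ) := pairwise_disjoint_atom C
  let Φ : ((ι → Bool) → ℝ≥0∞) → ι → ℝ≥0∞ := fun v i => ∑ σ, if σ i = true then v σ else 0
  have hΦ : Measurable Φ := by
    refine measurable_pi_lambda _ fun i => Finset.measurable_sum _ fun σ _ => ?_
    split_ifs
    · fun_prop
    · fun_prop
  have hΦm : ∀ m : Measure X, (fun i => m (C i)) = Φ fun σ => m (E σ) := fun m =>
    funext fun i => apply_eq_sum_atom hC m i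
  have hνE : ∀ σ : ι → Bool, σ j = true → ν (E σ) ≠ ∞ := fun σ hσ =>
    measure_ne_top_of_subset (fun z hz => by
      rw [← membershipPattern_eq_true (C := C), show membershipPattern C z = σ from hz, hσ]) hj
  have hNm : ∀ σ, Measurable fun ω => N ω (E σ) := fun σ => hN.measurable_apply (hEm σ)
  have hψN : Measurable fun ω => ψ (fun i => N ω (C i)) :=
    hψ.comp (measurable_pi_lambda _ fun i => hN.measurable_apply (hC i))
  have hCU : C j = ⋃ σ ∈ Finset.univ.filter (fun σ : ι → Bool => σ j = true), E σ := by
    ext z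
    simp [hE, ← membershipPattern_eq_true (C := C)]
  calc
    _ = ∫⁻ ω, ∑ σ : ι → Bool,
        (if σ j = true then N ω (E σ) else 0) * ψ (Φ fun σ => N ω (E σ)) ∂P := by
      refine lintegral_congr fun ω => ?_
      rw [hΦm, ← Finset.sum_mul]
      congr 1
      exact apply_eq_sum_atom hC (N ω) j
    _ = ∑ σ : ι → Bool, if σ j = true then
        ∫⁻ ω, N ω (E σ) * ψ (Φ fun σ => N ω (E σ)) ∂P else 0 := by
      rw [lintegral_finsetSum]
      · refine Finset.sum_congr rfl fun σ _ => ?_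
        split_ifs <;> simp
      · intro σ _
        simp only [← hΦm]
        split_ifs
        · exact (hNm σ).mul hψN
        · simp
    _ = ∑ σ : ι → Bool, if σ j = true then
        ∫⁻ z in E σ, ∫⁻ ω, ψ (fun i => (N ω + Measure.dirac z) (C i)) ∂P ∂ν else 0 := by
      refine Finset.sum_congr rfl fun σ _ => ?_
      split_ifs with hσ
      · refine (hN.lintegral_apply_mul hEm hEd (hψ.comp hΦ) (hνE σ hσ)).trans ?_
        have : ∀ z ∈ E σ, ∫⁻ ω, ψ (fun i => (N ω + Measure.dirac z) (C i)) ∂P =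
            ∫⁻ ω, (ψ ∘ Φ) (fun τ => N ω (E τ) + if τ = σ then 1 else 0) ∂P := by
          intro z hz
          refine lintegral_congr fun ω => ?_
          rw [hΦm]
          dsimp
          congr 2
          ext τ
          rw [Measure.dirac_apply' _ (hEm τ), indicator_apply]
          have : z ∈ E τ ↔ τ = σ := by
            change membershipPattern C z = τ ↔ τ = σ
            rw [show membershipPattern C z = σ from hz, eq_comm]
          simp [this]
        rw [setLIntegral_congr_fun (hEm σ) this, setLIntegral_const, mul_comm]
      · rfl
    _ = _ := by
      rw [← Finset.sum_filter, hCU]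
      exact (lintegral_biUnion_finset (fun σ _ τ _ h => hEd h) (fun σ _ => hEm σ) _).symm

theorem generateFrom_finite_measure (ν : Measure X) [SigmaFinite ν] :
    MeasurableSpace.generateFrom {B | MeasurableSet B ∧ ν B < ∞} = ‹MeasurableSpace X› := by
  refine le_antisymm (MeasurableSpace.generateFrom_le fun B hB => hB.1) fun B hB => ?_
  rw [← inter_univ B, ← iUnion_spanningSets ν, inter_iUnion]
  refine MeasurableSet.iUnion fun k => MeasurableSpace.measurableSet_generateFrom
    ⟨hB.inter (measurableSet_spanningSets ν k),
      (measure_mono inter_subset_right).trans_lt (measure_spanningSets_lt_top ν k)⟩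

theorem IsPoissonPointProcess.lintegral_apply {ν : Measure X} {N : Ω → Measure X}
    {P : Measure Ω} [IsProbabilityMeasure P] (hN : IsPoissonPointProcess N ν P) {B : Set X}
    (hB : MeasurableSet B) (hνB : ν B ≠ ∞) : ∫⁻ ω, N ω B ∂P = ν B := by
  have := hN.lintegral_apply_mul_comp (C := fun _ : Unit => B) (fun _ => hB)
    (ψ := fun _ => 1) measurable_const (j := ()) hνB
  simpa using this

theorem IsPoissonPointProcess.ae_isLocallyFinite {ν : Measure X} [SigmaFinite ν]
    {N : Ω → Measure X} {P : Measure Ω} [IsProbabilityMeasure P]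
    (hN : IsPoissonPointProcess N ν P) : ∀ᵐ ω ∂P, IsLocallyFinite ν (N ω) := by
  refine ae_all_iff.2 fun k => ae_lt_top (hN.measurable_apply (measurableSet_spanningSets ν k)) ?_
  rw [hN.lintegral_apply (measurableSet_spanningSets ν k) (measure_spanningSets_lt_top ν k).ne]
  exact (measure_spanningSets_lt_top ν k).ne

theorem IsPoissonPointProcess.congr {ν : Measure X} {N N' : Ω → Measure X} {P : Measure Ω}
    (hN : IsPoissonPointProcess N ν P) (hN' : Measurable N') (h : N =ᵐ[P] N') :
    IsPoissonPointProcess N' ν P where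
  measurable := hN'
  counting := by
    filter_upwards [hN.counting, h] with ω h1 h2
    rwa [← h2]
  poisson B hB hνB := (hN.poisson B hB hνB).congr (h.mono fun ω hω => by simp only [hω])
  indep n B hB hd := (hN.indep n B hB hd).congr fun i => h.mono fun ω hω => by simp only [hω]

theorem IsPoissonPointProcess.truncation {ν : Measure X} [SigmaFinite ν]
    {N : Ω → Measure X} {P : Measure Ω} [IsProbabilityMeasure P]
    (hN : IsPoissonPointProcess N ν P) :
    IsPoissonPointProcess (fun ω => truncation ν (N ω)) ν P :=
  hN.congr ((measurable_truncation ν).comp hN.measurable)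
    (hN.ae_isLocallyFinite.mono fun _ h => (truncation_of_isLocallyFinite h).symm)

/-- The σ-algebra on the space of measures generated by the evaluation at a single set. -/
@[reducible] def evaluationAlgebra (B : {B : Set X // MeasurableSet B}) :
    MeasurableSpace (Measure X) :=
  MeasurableSpace.comap (fun m : Measure X => m B.1) inferInstance

/-- The cylinder sets: those determined by the evaluations at finitely many members of `S`. -/
def cylinders (S : Set {B : Set X // MeasurableSet B}) : Set (Set (Measure X)) :=
  piiUnionInter (fun B : {B : Set X // MeasurableSet B} =>
    {A | MeasurableSet[evaluationAlgebra B] A}) S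

/-- The cylinder sets over `S` generate the σ-algebra on the space of measures as soon as the
evaluations at the members of `S` determine all the others measurably. -/
theorem generateFrom_cylinders (S : Set {B : Set X // MeasurableSet B})
    (hS : ∀ B, MeasurableSet B → Measurable[⨆ B ∈ S, evaluationAlgebra B]
      fun m : Measure X => m B) :
    MeasurableSpace.generateFrom (cylinders S) = Measure.instMeasurableSpace := by
  refine (generateFrom_piiUnionInter_measurableSet _ _).trans ?_
  refine le_antisymm (iSup₂_le fun B _ => (Measure.measurable_coe B.2).comap_le) ?_
  refine iSup₂_le fun B hB => ?_
  rw [← BorelSpace.measurable_eq (α := ℝ≥0∞)]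
  exact (hS B hB).comap_le

theorem isPiSystem_cylinders (S : Set {B : Set X // MeasurableSet B}) :
    IsPiSystem (cylinders S) :=
  isPiSystem_piiUnionInter _ (fun B => @MeasurableSpace.isPiSystem_measurableSet _
    (evaluationAlgebra B)) S

theorem exists_of_mem_cylinders {S : Set {B : Set X // MeasurableSet B}} {A : Set (Measure X)}
    (hA : A ∈ cylinders S) :
    ∃ (t : Finset {B : Set X // MeasurableSet B}) (V : Set (t → ℝ≥0∞)), (↑t ⊆ S) ∧
      MeasurableSet V ∧ A = (fun (m : Measure X) (B : t) => m B.1.1) ⁻¹' V := by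
  obtain ⟨t, htS, f, hf, rfl⟩ := hA
  choose! g hg1 hg2 using hf
  refine ⟨t, ⋂ B : t, (fun v => v B) ⁻¹' g B.1, htS,
    MeasurableSet.iInter fun B => measurable_pi_apply B (hg1 B.1 B.2), ?_⟩
  ext m
  simp only [mem_iInter, mem_preimage]
  refine ⟨fun h B => ?_, fun h B hB => ?_⟩
  · have := h B.1 B.2
    rwa [← hg2 B.1 B.2] at this
  · rw [← hg2 B hB]
    exact h ⟨B, hB⟩

end

/-! ### The Mecke formula and the uniqueness of the law -/

section

variable {Ω X : Type*} [MeasurableSpace Ω] [MeasurableSpace X]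

theorem IsPoissonPointProcess.lintegral_cylinder {ν : Measure X} {N : Ω → Measure X}
    {P : Measure Ω} [IsProbabilityMeasure P] (hN : IsPoissonPointProcess N ν P)
    {B : Set X} (hB : MeasurableSet B) (hνB : ν B ≠ ∞)
    {S : Set {B : Set X // MeasurableSet B}} {A : Set (Measure X)} (hA : A ∈ cylinders S) :
    ∫⁻ ω, N ω B * A.indicator 1 (N ω) ∂P =
      ∫⁻ z in B, ∫⁻ ω, A.indicator 1 (N ω + Measure.dirac z) ∂P ∂ν := by
  obtain ⟨t, V, -, hV, rfl⟩ := exists_of_mem_cylinders hA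
  let C : Option t → Set X := fun o => o.elim B fun B' => B'.1.1
  have hC : ∀ i, MeasurableSet (C i) := by
    rintro (_ | i)
    · exact hB
    · exact i.1.2
  let ψ : (Option t → ℝ≥0∞) → ℝ≥0∞ := fun v => V.indicator 1 fun B' => v (some B')
  have hψ : Measurable ψ :=
    (measurable_one.indicator hV).comp (measurable_pi_lambda _ fun i => measurable_pi_apply _)
  exact hN.lintegral_apply_mul_comp hC hψ (j := none) hνB

/-- **Mecke formula** for measurable functionals: a Poisson process seen from one of its points is
the same Poisson process with that point added. -/
theorem IsPoissonPointProcess.mecke_of_measurable {ν : Measure X} [SigmaFinite ν]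
    {N : Ω → Measure X} {P : Measure Ω} [IsProbabilityMeasure P]
    (hN : IsPoissonPointProcess N ν P) (hfin : ∀ ω, IsLocallyFinite ν (N ω))
    {f : X × Measure X → ℝ≥0∞} (hf : Measurable f) :
    ∫⁻ ω, ∫⁻ z, f (z, N ω) ∂(N ω) ∂P = ∫⁻ z, ∫⁻ ω, f (z, N ω + Measure.dirac z) ∂P ∂ν := by
  let κ : Kernel Ω X := ⟨N, hN.measurable⟩
  have hκ : IsSFiniteKernel κ := isSFiniteKernel_of_isLocallyFinite (ν := ν) κ hfin
  have hg1 : Measurable fun p : Ω × X => (p.2, N p.1) :=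
    measurable_snd.prodMk (hN.measurable.comp measurable_fst)
  have hg2 : Measurable fun p : X × Ω => (p.1, N p.2 + Measure.dirac p.1) :=
    measurable_fst.prodMk (measurable_add_dirac.comp
      (measurable_fst.prodMk (hN.measurable.comp measurable_snd)))
  let M1 : Measure (X × Measure X) := (P ⊗ₘ κ).map fun p => (p.2, N p.1)
  let M2 : Measure (X × Measure X) := (ν.prod P).map fun p => (p.1, N p.2 + Measure.dirac p.1)
  have e1 : ∀ g : X × Measure X → ℝ≥0∞, Measurable g →
      ∫⁻ p, g p ∂M1 = ∫⁻ ω, ∫⁻ z, g (z, N ω) ∂(N ω) ∂P := by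
    intro g hg
    exact (lintegral_map hg hg1).trans (Measure.lintegral_compProd (hg.comp hg1))
  have e2 : ∀ g : X × Measure X → ℝ≥0∞, Measurable g →
      ∫⁻ p, g p ∂M2 = ∫⁻ z, ∫⁻ ω, g (z, N ω + Measure.dirac z) ∂P ∂ν := by
    intro g hg
    exact (lintegral_map hg hg2).trans (lintegral_prod _ (hg.comp hg2).aemeasurable)
  rw [← e1 f hf, ← e2 f hf]
  suffices M1 = M2 by rw [this]
  have hcyl : MeasurableSpace.generateFrom (cylinders (X := X) univ) =
      Measure.instMeasurableSpace := by
    refine generateFrom_cylinders _ fun B hB => ?_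
    refine Measurable.mono (ma := evaluationAlgebra ⟨B, hB⟩) ?_
      (le_iSup₂_of_le ⟨B, hB⟩ (mem_univ _) le_rfl) le_rfl
    exact comap_measurable _
  have hempty : (univ : Set (Measure X)) ∈ cylinders (X := X) univ :=
    ⟨∅, by simp, fun _ => univ, by simp, by simp⟩
  have hspan : ∀ k, spanningSets ν k ∈ {B | MeasurableSet B ∧ ν B < ∞} := fun k =>
    ⟨measurableSet_spanningSets ν k, measure_spanningSets_lt_top ν k⟩
  have key : ∀ B A, MeasurableSet B → ν B < ∞ → A ∈ cylinders (X := X) univ →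
      M1 (B ×ˢ A) = M2 (B ×ˢ A) := by
    intro B A hB hνB hA
    have hAm : MeasurableSet A := by
      rw [← hcyl]; exact MeasurableSpace.measurableSet_generateFrom hA
    have hi : ∀ z m, (B ×ˢ A).indicator (1 : X × Measure X → ℝ≥0∞) (z, m) =
        B.indicator 1 z * A.indicator 1 m := by
      intro z m
      by_cases h1 : z ∈ B <;> by_cases h2 : m ∈ A <;> simp [h1, h2]
    rw [← lintegral_indicator_one (hB.prod hAm), ← lintegral_indicator_one (hB.prod hAm),
      e1 _ (measurable_one.indicator (hB.prod hAm)), e2 _ (measurable_one.indicator (hB.prod hAm))]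
    simp only [hi]
    have hA1 : Measurable (A.indicator (1 : Measure X → ℝ≥0∞)) := measurable_one.indicator hAm
    have l1 : ∀ ω, ∫⁻ z, B.indicator 1 z * A.indicator 1 (N ω) ∂(N ω) =
        N ω B * A.indicator 1 (N ω) := by
      intro ω
      rw [lintegral_mul_const _ (measurable_one.indicator hB), lintegral_indicator_one hB]
    have l2 : ∀ z, ∫⁻ ω, B.indicator 1 z * A.indicator 1 (N ω + Measure.dirac z) ∂P =
        B.indicator (fun z => ∫⁻ ω, A.indicator 1 (N ω + Measure.dirac z) ∂P) z := by
      intro z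
      by_cases h1 : z ∈ B <;> simp [h1]
    simp only [l1, l2]
    rw [lintegral_indicator hB, hN.lintegral_cylinder hB hνB.ne hA]
  refine Measure.ext_of_generateFrom_of_iUnion
    (image2 (· ×ˢ ·) {B | MeasurableSet B ∧ ν B < ∞} (cylinders univ))
    (fun k => spanningSets ν k ×ˢ univ) ?_ ?_ ?_ ?_ ?_ ?_
  · have h1 : IsCountablySpanning {B | MeasurableSet B ∧ ν B < ∞} :=
      ⟨spanningSets ν, hspan, iUnion_spanningSets ν⟩
    have h2 : IsCountablySpanning (cylinders (X := X) univ) :=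
      ⟨fun _ => univ, fun _ => hempty, iUnion_const _⟩
    rw [← generateFrom_prod_eq h1 h2, generateFrom_finite_measure, hcyl]
  · refine IsPiSystem.prod ?_ (isPiSystem_cylinders _)
    exact fun B hB C hC _ => ⟨hB.1.inter hC.1, (measure_mono inter_subset_left).trans_lt hB.2⟩
  · rw [← iUnion_prod_const, iUnion_spanningSets, univ_prod_univ]
  · exact fun k => ⟨_, hspan k, _, hempty, rfl⟩
  · intro k
    have : M1 (spanningSets ν k ×ˢ univ) = ν (spanningSets ν k) := by
      rw [key _ _ (hspan k).1 (hspan k).2 hempty,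
        ← lintegral_indicator_one ((hspan k).1.prod MeasurableSet.univ),
        e2 _ (measurable_one.indicator ((hspan k).1.prod MeasurableSet.univ)),
        ← lintegral_indicator_one (hspan k).1]
      refine lintegral_congr fun z => ?_
      by_cases h1 : z ∈ spanningSets ν k <;> simp [h1]
    change M1 (spanningSets ν k ×ˢ univ) ≠ ∞
    rw [this]
    exact (hspan k).2.ne
  · rintro _ ⟨B, hB, A, hA, rfl⟩
    exact key B A hB.1 hB.2 hA

/-- **Mecke formula**, for functionals that are measurable on the locally finite measures. -/
theorem IsPoissonPointProcess.mecke {ν : Measure X} [SigmaFinite ν]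
    {N : Ω → Measure X} {P : Measure Ω} [IsProbabilityMeasure P]
    (hN : IsPoissonPointProcess N ν P) (hfin : ∀ ω, IsLocallyFinite ν (N ω))
    {f : X → Measure X → ℝ≥0∞}
    (hf : Measurable fun p : X × Measure X => f p.1 (PitmanYor.truncation ν p.2)) :
    ∫⁻ ω, ∫⁻ z, f z (N ω) ∂(N ω) ∂P = ∫⁻ z, ∫⁻ ω, f z (N ω + Measure.dirac z) ∂P ∂ν := by
  have := hN.mecke_of_measurable hfin hf
  simp only [truncation_of_isLocallyFinite (hfin _),
    truncation_of_isLocallyFinite ((hfin _).add_dirac _)] at this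
  exact this

theorem IsPoissonPointProcess.map_eq_pi {ν : Measure X} {N : Ω → Measure X} {P : Measure Ω}
    [IsProbabilityMeasure P] (hN : IsPoissonPointProcess N ν P) {ι : Type*} [Fintype ι]
    {E : ι → Set X} (hE : ∀ i, MeasurableSet (E i))
    (hd : Pairwise fun i j => Disjoint (E i) (E j)) (hν : ∀ i, ν (E i) ≠ ∞) :
    P.map (fun ω i => N ω (E i)) =
      Measure.pi fun i => (poissonMeasure (ν (E i)).toNNReal).map (Nat.cast : ℕ → ℝ≥0∞) := by
  have h1 := (iIndepFun_iff_map_fun_eq_pi_map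
    (fun i => (hN.measurable_apply (hE i)).aemeasurable)).1 (hN.iIndepFun_of_disjoint hE hd)
  simpa only [fun σ => (hN.poisson _ (hE σ) (hν σ)).map_eq] using h1

theorem IsPoissonPointProcess.map_apply_eq_of_mem_cylinders {Ω' : Type*} [MeasurableSpace Ω']
    {ν : Measure X} {N : Ω → Measure X} {N' : Ω' → Measure X} {P : Measure Ω} {P' : Measure Ω'}
    [IsProbabilityMeasure P] [IsProbabilityMeasure P'] (hN : IsPoissonPointProcess N ν P)
    (hN' : IsPoissonPointProcess N' ν P') {A : Set (Measure X)}
    (hA : A ∈ cylinders {B | ν B.1 < ∞}) (hAm : MeasurableSet A) : P.map N A = P'.map N' A := by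
  classical
  obtain ⟨t, V, htS, hV, rfl⟩ := exists_of_mem_cylinders hA
  let C : t → Set X := fun B => B.1.1
  have hC : ∀ i, MeasurableSet (C i) := fun i => i.1.2
  -- only the atoms inside some `C i` have finite intensity, so the remaining atom is left out
  let ι := {σ : t → Bool // ∃ i, σ i = true}
  let E : ι → Set X := fun σ => membershipPattern C ⁻¹' {σ.1}
  have hEm : ∀ σ, MeasurableSet (E σ) := fun σ => measurableSet_atom hC σ.1
  have hEd : Pairwise fun σ τ => Disjoint (E σ) (E τ) := fun σ τ h =>
    pairwise_disjoint_atom C (Subtype.val_injective.ne h)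
  have hνE : ∀ σ, ν (E σ) ≠ ∞ := by
    rintro ⟨σ, i, hi⟩
    refine measure_ne_top_of_subset (s := C i) (fun z hz => ?_) (htS i.2).ne
    rw [← membershipPattern_eq_true (C := C), show membershipPattern C z = σ from hz, hi]
  let Φ : (ι → ℝ≥0∞) → t → ℝ≥0∞ := fun v i => ∑ σ, if σ.1 i = true then v σ else 0
  have hΦ : Measurable Φ := by
    refine measurable_pi_lambda _ fun i => Finset.measurable_sum _ fun σ _ => ?_
    split_ifs
    · fun_prop
    · fun_prop
  have hΦm : ∀ m : Measure X, (fun i => m (C i)) = Φ fun σ => m (E σ) := by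
    intro m
    ext i
    rw [apply_eq_sum_atom hC m i]
    change _ = ∑ σ : ι, if σ.1 i = true then m (E σ) else 0
    rw [← Finset.sum_filter, ← Finset.sum_filter]
    symm
    refine Finset.sum_bij (fun σ _ => σ.1) ?_ ?_ ?_ ?_
    · intro σ hσ; simpa using hσ
    · intro σ _ τ _ h; exact Subtype.ext h
    · intro σ hσ
      exact ⟨⟨σ, i, by simpa using hσ⟩, by simpa using hσ, rfl⟩
    · intro σ _; rfl
  have hpre : (fun (m : Measure X) (B : t) => m B.1.1) ⁻¹' V =
      (fun (m : Measure X) (σ : ι) => m (E σ)) ⁻¹' (Φ ⁻¹' V) := by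
    ext m
    change (fun i => m (C i)) ∈ V ↔ _
    rw [hΦm]
    rfl
  have hEV : Measurable fun (m : Measure X) (σ : ι) => m (E σ) :=
    measurable_pi_lambda _ fun σ => Measure.measurable_coe (hEm σ)
  rw [hpre, ← Measure.map_apply hEV (hΦ hV), ← Measure.map_apply hEV (hΦ hV),
    Measure.map_map hEV hN.measurable, Measure.map_map hEV hN'.measurable]
  exact congrArg (· (Φ ⁻¹' V)) ((hN.map_eq_pi hEm hEd hνE).trans (hN'.map_eq_pi hEm hEd hνE).symm)

/-- The law of a Poisson point process is determined by its intensity. -/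
theorem IsPoissonPointProcess.map_eq {Ω' : Type*} [MeasurableSpace Ω']
    {ν : Measure X} [SigmaFinite ν] {N : Ω → Measure X} {N' : Ω' → Measure X}
    {P : Measure Ω} {P' : Measure Ω'} [IsProbabilityMeasure P] [IsProbabilityMeasure P']
    (hN : IsPoissonPointProcess N ν P) (hN' : IsPoissonPointProcess N' ν P') :
    P.map N = P'.map N' := by
  have hcyl : MeasurableSpace.generateFrom
      (cylinders {B : {B : Set X // MeasurableSet B} | ν B.1 < ∞}) =
      Measure.instMeasurableSpace := by
    refine generateFrom_cylinders _ fun B hB => ?_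
    have hmono : Monotone fun k => B ∩ spanningSets ν k := fun i j h =>
      inter_subset_inter_right _ (monotone_spanningSets ν h)
    have h1 : (fun m : Measure X => m B) = fun m => ⨆ k, m (B ∩ spanningSets ν k) := by
      ext m
      rw [← hmono.measure_iUnion, ← inter_iUnion, iUnion_spanningSets, inter_univ]
    rw [h1]
    refine Measurable.iSup fun k => ?_
    have hk : MeasurableSet (B ∩ spanningSets ν k) := hB.inter (measurableSet_spanningSets ν k)
    refine Measurable.mono (ma := evaluationAlgebra ⟨_, hk⟩) ?_
      (le_iSup₂_of_le ⟨_, hk⟩ ((measure_mono inter_subset_right).trans_lt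
        (measure_spanningSets_lt_top ν k)) le_rfl) le_rfl
    exact comap_measurable _
  have : IsProbabilityMeasure (P.map N) :=
    Measure.isProbabilityMeasure_map hN.measurable.aemeasurable
  have : IsProbabilityMeasure (P'.map N') :=
    Measure.isProbabilityMeasure_map hN'.measurable.aemeasurable
  refine ext_of_generate_finite _ hcyl.symm (isPiSystem_cylinders _) (fun A hA => ?_) (by simp)
  refine hN.map_apply_eq_of_mem_cylinders hN' hA ?_
  rw [← hcyl]
  exact MeasurableSpace.measurableSet_generateFrom hA

theorem IsPoissonPointProcess.lintegral_eq_lintegral_map {ν : Measure X} [SigmaFinite ν]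
    {N : Ω → Measure X} {P : Measure Ω} [IsProbabilityMeasure P]
    (hN : IsPoissonPointProcess N ν P)
    {G : Measure X → ℝ≥0∞} (hG : Measurable fun m => G (PitmanYor.truncation ν m)) :
    ∫⁻ ω, G (N ω) ∂P = ∫⁻ m, G (PitmanYor.truncation ν m) ∂(P.map N) := by
  rw [lintegral_map hG hN.measurable]
  refine lintegral_congr_ae ?_
  filter_upwards [hN.ae_isLocallyFinite] with ω hω
  rw [truncation_of_isLocallyFinite hω]

/-- Expectations of functionals agree for Poisson processes with the same intensity. Measurability
of the functional is needed on the locally finite measures only. -/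
theorem IsPoissonPointProcess.lintegral_eq {Ω' : Type*} [MeasurableSpace Ω']
    {ν : Measure X} [SigmaFinite ν] {N : Ω → Measure X} {N' : Ω' → Measure X}
    {P : Measure Ω} {P' : Measure Ω'} [IsProbabilityMeasure P] [IsProbabilityMeasure P']
    (hN : IsPoissonPointProcess N ν P) (hN' : IsPoissonPointProcess N' ν P')
    {G : Measure X → ℝ≥0∞} (hG : Measurable fun m => G (PitmanYor.truncation ν m)) :
    ∫⁻ ω, G (N ω) ∂P = ∫⁻ ω, G (N' ω) ∂P' := by
  rw [hN.lintegral_eq_lintegral_map hG, hN'.lintegral_eq_lintegral_map hG, hN.map_eq hN']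

theorem IsCountingMeasure.map {Y : Type*} [MeasurableSpace Y] {m : Measure X}
    (hm : IsCountingMeasure m) {φ : X → Y} (hφ : Measurable φ) : IsCountingMeasure (m.map φ) := by
  obtain ⟨I, x, rfl⟩ := hm
  refine ⟨I, fun i => φ (x i), ?_⟩
  rw [Measure.map_sum hφ.aemeasurable]
  simp only [Measure.map_dirac' hφ]

/-- Mapping theorem for Poisson point processes. -/
theorem IsPoissonPointProcess.map {Y : Type*} [MeasurableSpace Y] {ν : Measure X}
    {N : Ω → Measure X} {P : Measure Ω} (hN : IsPoissonPointProcess N ν P) {φ : X → Y}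
    (hφ : Measurable φ) : IsPoissonPointProcess (fun ω => (N ω).map φ) (ν.map φ) P where
  measurable := (Measure.measurable_map φ hφ).comp hN.measurable
  counting := hN.counting.mono fun ω h => h.map hφ
  poisson B hB hνB := by
    rw [Measure.map_apply hφ hB] at hνB ⊢
    simp only [Measure.map_apply hφ hB]
    exact hN.poisson _ (hφ hB) hνB
  indep n B hB hd := by
    simp only [Measure.map_apply hφ (hB _)]
    exact hN.indep n _ (fun i => hφ (hB i)) fun i j h => (hd h).preimage φ

end

/-! ### The stable Lévy measure -/

section

variable {Ω X : Type*} [MeasurableSpace Ω] [MeasurableSpace X]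

instance sigmaFinite_stableLevyMeasure (α K : ℝ) : SigmaFinite (stableLevyMeasure α K) :=
  SigmaFinite.withDensity_ofReal _

/-- The intensity `Leb × μ_α` of the jumps of an `α`-stable subordinator. -/
noncomputable abbrev stableIntensity (α K : ℝ) : Measure (ℝ × ℝ) :=
  (volume.restrict (Ioi 0)).prod (stableLevyMeasure α K)

theorem lintegral_stableLevyMeasure (α K : ℝ) {h : ℝ → ℝ≥0∞} (hh : Measurable h) :
    ∫⁻ u, h u ∂(stableLevyMeasure α K) =
      ∫⁻ u in Ioi 0, ENNReal.ofReal (K * α * u ^ (-α - 1)) * h u := by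
  rw [stableLevyMeasure, lintegral_withDensity_eq_lintegral_mul _ (by fun_prop) hh]
  rfl

theorem stableLevyMeasure_Ioi {α K : ℝ} (hα : 0 < α) (hK : 0 < K) {u : ℝ} (hu : 0 < u) :
    stableLevyMeasure α K (Ioi u) = ENNReal.ofReal (K * u ^ (-α)) := by
  rw [stableLevyMeasure, withDensity_apply _ measurableSet_Ioi,
    Measure.restrict_restrict measurableSet_Ioi,
    inter_eq_left.2 (Ioi_subset_Ioi hu.le)]
  have hi : IntegrableOn (fun x : ℝ => K * α * x ^ (-α - 1)) (Ioi u) :=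
    (integrableOn_Ioi_rpow_of_lt (by linarith) hu).const_mul _
  rw [← ofReal_integral_eq_lintegral_ofReal hi]
  · rw [integral_const_mul, integral_Ioi_rpow_of_lt (by linarith) hu]
    congr 1
    rw [show -α - 1 + 1 = -α by ring]
    field_simp
  · filter_upwards [ae_restrict_mem measurableSet_Ioi] with x hx
    have hx' : 0 < x := hu.trans hx
    change 0 ≤ K * α * x ^ (-α - 1)
    positivity

theorem lintegral_Iic_stableLevyMeasure_lt_top {α K : ℝ} (hα : α ∈ Ioo (0 : ℝ) 1) (hK : 0 < K)
    (M : ℝ) : ∫⁻ u in Iic M, ENNReal.ofReal u ∂(stableLevyMeasure α K) < ∞ := by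
  rw [← lintegral_indicator measurableSet_Iic,
    lintegral_stableLevyMeasure _ _ (by fun_prop (disch := measurability))]
  rcases le_or_gt M 0 with hM | hM
  · refine lt_of_le_of_lt (le_of_eq ?_) ENNReal.zero_lt_top
    rw [lintegral_eq_zero_iff (by fun_prop (disch := measurability))]
    filter_upwards with u
    by_cases h : u ≤ M
    · simp [h, ENNReal.ofReal_of_nonpos (h.trans hM)]
    · simp [h]
  have hi : IntegrableOn (fun x : ℝ => K * α * x ^ (-α)) (Ioc 0 M) := by
    refine Integrable.const_mul ?_ _
    exact (intervalIntegrable_iff_integrableOn_Ioc_of_le hM.le).1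
      (intervalIntegral.intervalIntegrable_rpow' (by linarith [hα.2]))
  have h1 : ∀ u ∈ Ioi (0 : ℝ), ENNReal.ofReal (K * α * u ^ (-α - 1)) *
      (Iic M).indicator (fun u => ENNReal.ofReal u) u =
      (Iic M).indicator (fun u => ENNReal.ofReal (K * α * u ^ (-α))) u := by
    intro u hu
    by_cases h : u ≤ M
    · have hu' : 0 < u := hu
      have hα' := hα.1
      simp only [mem_Iic, h, indicator_of_mem]
      rw [← ENNReal.ofReal_mul (by positivity), mul_assoc]
      congr 2
      nth_rw 2 [← Real.rpow_one u]
      rw [← Real.rpow_add hu']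
      ring_nf
    · simp [h]
  rw [setLIntegral_congr_fun measurableSet_Ioi h1, setLIntegral_indicator measurableSet_Iic,
    Iic_inter_Ioi]
  exact hi.setLIntegral_lt_top

theorem smul_stableLevyMeasure (α K : ℝ) {c : ℝ} (hc : 0 ≤ c) :
    ENNReal.ofReal c • stableLevyMeasure α K = stableLevyMeasure α (c * K) := by
  rw [stableLevyMeasure, ← withDensity_smul _ (by fun_prop), stableLevyMeasure]
  congr 1
  ext u
  rw [Pi.smul_apply, smul_eq_mul, ← ENNReal.ofReal_mul hc]
  ring_nf

theorem lintegral_comp_mul_left_real {b : ℝ} (hb : 0 < b) {g : ℝ → ℝ≥0∞} (hg : Measurable g) :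
    ∫⁻ u, g (b * u) = ENNReal.ofReal b⁻¹ * ∫⁻ u, g u := by
  rw [← lintegral_map (g := fun u => b * u) hg (by fun_prop), Real.map_volume_mul_left hb.ne',
    lintegral_smul_measure, abs_of_pos (inv_pos.2 hb), smul_eq_mul]

theorem map_mul_left_volume_Ioi {a : ℝ} (ha : 0 < a) :
    (volume.restrict (Ioi (0 : ℝ))).map (a * ·) =
      ENNReal.ofReal a⁻¹ • volume.restrict (Ioi (0 : ℝ)) := by
  have : (a * ·) ⁻¹' Ioi (0 : ℝ) = Ioi 0 := by ext x; simp [ha]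
  conv_lhs => rw [← this]
  rw [← Measure.restrict_map (by fun_prop) measurableSet_Ioi, Real.map_volume_mul_left ha.ne',
    abs_of_pos (inv_pos.2 ha), Measure.restrict_smul]

theorem map_mul_left_stableLevyMeasure (α K : ℝ) {b : ℝ} (hb : 0 < b) :
    (stableLevyMeasure α K).map (b * ·) = stableLevyMeasure α (b ^ α * K) := by
  refine Measure.ext_of_lintegral _ fun h hh => ?_
  rw [lintegral_map hh (by fun_prop), lintegral_stableLevyMeasure _ _ (by fun_prop),
    lintegral_stableLevyMeasure _ _ hh, ← lintegral_indicator measurableSet_Ioi,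
    ← lintegral_indicator measurableSet_Ioi]
  have h1 : ∀ u, (Ioi (0 : ℝ)).indicator
      (fun u => ENNReal.ofReal (K * α * u ^ (-α - 1)) * h (b * u)) u =
      ENNReal.ofReal b * (Ioi (0 : ℝ)).indicator
      (fun u => ENNReal.ofReal (b ^ α * K * α * u ^ (-α - 1)) * h u) (b * u) := by
    intro u
    by_cases hu : 0 < u
    · have hbu : 0 < b * u := mul_pos hb hu
      rw [indicator_of_mem (show u ∈ Ioi (0 : ℝ) from hu),
        indicator_of_mem (show b * u ∈ Ioi (0 : ℝ) from hbu)]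
      rw [← mul_assoc, ← ENNReal.ofReal_mul hb.le]
      congr 2
      rw [Real.mul_rpow hb.le hu.le]
      have : b ^ α * b ^ (-α - 1) * b = 1 := by
        nth_rw 3 [← Real.rpow_one b]
        rw [← Real.rpow_add hb, ← Real.rpow_add hb]
        rw [show α + (-α - 1) + 1 = 0 by ring, Real.rpow_zero]
      linear_combination (-(K * α * u ^ (-α - 1))) * this
    · have hbu : ¬ 0 < b * u := fun h => hu ((mul_pos_iff_of_pos_left hb).1 h)
      simp [hu, hbu]
  simp only [h1]
  have hm : Measurable ((Ioi (0 : ℝ)).indicator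
      (fun u => ENNReal.ofReal (b ^ α * K * α * u ^ (-α - 1)) * h u)) :=
    Measurable.indicator (by fun_prop) measurableSet_Ioi
  rw [lintegral_const_mul' _ _ ENNReal.ofReal_ne_top, lintegral_comp_mul_left_real hb hm,
    ← mul_assoc, ← ENNReal.ofReal_mul hb.le, mul_inv_cancel₀ hb.ne', ENNReal.ofReal_one, one_mul]

/-- The scaling `(t, p) ↦ (a t, b p)` of jump times and jump sizes. -/
def scaling (a b : ℝ) (z : ℝ × ℝ) : ℝ × ℝ := (a * z.1, b * z.2)

theorem measurable_scaling (a b : ℝ) : Measurable (scaling a b) := by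
  unfold scaling; fun_prop

theorem map_scaling_stableIntensity (α K : ℝ) {a b : ℝ} (ha : 0 < a) (hb : 0 < b) :
    (stableIntensity α K).map (scaling a b) = stableIntensity α (a⁻¹ * (b ^ α * K)) := by
  have : scaling a b = Prod.map (a * ·) (b * ·) := rfl
  rw [this, ← Measure.map_prod_map _ _ (by fun_prop) (by fun_prop), map_mul_left_volume_Ioi ha,
    map_mul_left_stableLevyMeasure _ _ hb, Measure.prod_smul_left, ← Measure.prod_smul_right,
    smul_stableLevyMeasure _ _ (inv_pos.2 ha).le]

theorem stableIntensity_prod (α K : ℝ) (A B : Set ℝ) :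
    stableIntensity α K (A ×ˢ B) = (volume.restrict (Ioi 0)) A * stableLevyMeasure α K B :=
  Measure.prod_prod A B

theorem stableLevyMeasure_Iic (α K : ℝ) : stableLevyMeasure α K (Iic 0) = 0 := by
  rw [stableLevyMeasure]
  refine withDensity_absolutelyContinuous _ _ ?_
  rw [Measure.restrict_apply measurableSet_Iic, Iic_inter_Ioi, Ioc_self, measure_empty]

theorem stableIntensity_singleton_prod (α K t : ℝ) :
    stableIntensity α K {w | w.1 = t} = 0 := by
  have : {w : ℝ × ℝ | w.1 = t} = {t} ×ˢ univ := by ext w; simp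
  rw [this, stableIntensity_prod, measure_singleton, zero_mul]

theorem stableIntensity_compl_quadrant (α K : ℝ) :
    stableIntensity α K (Ioi 0 ×ˢ Ioi 0)ᶜ = 0 := by
  have : (Ioi (0 : ℝ) ×ˢ Ioi (0 : ℝ))ᶜ = Iic 0 ×ˢ univ ∪ univ ×ˢ Iic 0 := by
    rw [compl_prod_eq_union, compl_Ioi]
  rw [this, measure_union_null_iff, stableIntensity_prod, stableIntensity_prod,
    stableLevyMeasure_Iic, Measure.restrict_apply measurableSet_Iic, Iic_inter_Ioi]
  simp

theorem stableIntensity_Iio_prod_Ioi {α K : ℝ} (hα : 0 < α) (hK : 0 < K) (t : ℝ) {u : ℝ}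
    (hu : 0 < u) : stableIntensity α K (Iio t ×ˢ Ioi u) =
      ENNReal.ofReal t * ENNReal.ofReal (K * u ^ (-α)) := by
  rw [stableIntensity_prod, stableLevyMeasure_Ioi hα hK hu,
    Measure.restrict_apply measurableSet_Iio, Iio_inter_Ioi, Real.volume_Ioo, sub_zero]

theorem IsPoissonPointProcess.ae_apply_eq_zero {ν : Measure X} {N : Ω → Measure X} {P : Measure Ω}
    [IsProbabilityMeasure P] (hN : IsPoissonPointProcess N ν P) {B : Set X}
    (hB : MeasurableSet B) (hνB : ν B = 0) : ∀ᵐ ω ∂P, N ω B = 0 := by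
  have := hN.lintegral_apply hB (by simp [hνB])
  rw [hνB, lintegral_eq_zero_iff (hN.measurable_apply hB)] at this
  exact this

theorem IsPoissonPointProcess.measure_apply_eq_zero {ν : Measure X} {N : Ω → Measure X}
    {P : Measure Ω} (hN : IsPoissonPointProcess N ν P) {B : Set X}
    (hB : MeasurableSet B) (hνB : ν B ≠ ∞) :
    P {ω | N ω B = 0} = ENNReal.ofReal (Real.exp (-(ν B).toReal)) := by
  have h := congrArg (· {(0 : ℝ≥0∞)}) (hN.poisson B hB hνB).map_eq
  have hc : Measurable (Nat.cast : ℕ → ℝ≥0∞) := measurable_from_top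
  have h0 : (Nat.cast : ℕ → ℝ≥0∞) ⁻¹' {0} = {0} := by ext n; simp
  simp only [Measure.map_apply (hN.measurable_apply hB) (measurableSet_singleton _),
    Measure.map_apply hc (measurableSet_singleton _), h0, poissonMeasure_singleton] at h
  simp only [pow_zero, mul_one, Nat.factorial_zero, Nat.cast_one, div_one] at h
  exact h

end

/-! ### Functionals of the jumps before a time -/

/-- The point process of the sizes of the jumps at times `< t`. -/
noncomputable def jumpsBefore (m : Measure (ℝ × ℝ)) (t : ℝ) : Measure ℝ :=
  (m.restrict (Iio t ×ˢ univ)).map Prod.snd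

/-- The sum of the points of a point process on the half-line. -/
noncomputable def totalSize (j : Measure ℝ) : ℝ≥0∞ := ∫⁻ x, ENNReal.ofReal x ∂j

/-- The points of `j` divided by `T`, together with the point that makes the sum equal to one. -/
noncomputable def completion (T : ℝ) (j : Measure ℝ) : Measure ℝ :=
  j.map (fun x => x / T) + Measure.dirac ((T - (totalSize j).toReal) / T)

/-- The jump `z` carries the subordinator strictly across the level `T`, from the value of the
sum of the earlier jumps. -/
def Straddles (T : ℝ) (m : Measure (ℝ × ℝ)) (z : ℝ × ℝ) : Prop :=
  totalSize (jumpsBefore m z.1) < ENNReal.ofReal T ∧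
    ENNReal.ofReal T < totalSize (jumpsBefore m z.1) + ENNReal.ofReal z.2

theorem selfNormalize_eq (j : Measure ℝ) :
    selfNormalize j = j.map (fun x => x / (totalSize j).toReal) := rfl

theorem jumpsBefore_apply (m : Measure (ℝ × ℝ)) (t : ℝ) {B : Set ℝ} (hB : MeasurableSet B) :
    jumpsBefore m t B = m {z | z.1 < t ∧ z.2 ∈ B} := by
  rw [jumpsBefore, Measure.map_apply measurable_snd hB,
    Measure.restrict_apply (measurable_snd hB)]
  congr 1
  ext z
  simp [and_comm]

theorem totalSize_jumpsBefore (m : Measure (ℝ × ℝ)) (t : ℝ) :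
    totalSize (jumpsBefore m t) =
      ∫⁻ z, (Iio t ×ˢ univ).indicator (fun z => ENNReal.ofReal z.2) z ∂m := by
  rw [totalSize, jumpsBefore, lintegral_map (by fun_prop) measurable_snd,
    lintegral_indicator (measurableSet_Iio.prod MeasurableSet.univ)]

section Measurability

variable {γ : Type*} [MeasurableSpace γ] (ν : Measure (ℝ × ℝ)) [SigmaFinite ν]
  {m : γ → Measure (ℝ × ℝ)} (hm : Measurable m) (hfin : ∀ c, IsLocallyFinite ν (m c))
  {t r T : γ → ℝ} (ht : Measurable t) (hr : Measurable r) (hT : Measurable T)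

include hm hfin ht

theorem measurable_totalSize_jumpsBefore :
    Measurable fun c => totalSize (jumpsBefore (m c) (t c)) := by
  simp only [totalSize_jumpsBefore]
  refine measurable_lintegral_of_isLocallyFinite ν hm hfin ?_
  have h1 : Measurable fun p : γ × (ℝ × ℝ) => ENNReal.ofReal p.2.2 := by fun_prop
  have h2 : MeasurableSet {p : γ × (ℝ × ℝ) | p.2.1 < t p.1} :=
    measurableSet_lt (by fun_prop) (by fun_prop)
  convert h1.indicator h2 using 1
  ext p
  simp [Function.uncurry, indicator_apply]

include hr in
theorem measurable_map_div_jumpsBefore :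
    Measurable fun c => (jumpsBefore (m c) (t c)).map fun x => x / r c := by
  refine Measure.measurable_of_measurable_coe _ fun B hB => ?_
  have h1 : ∀ c, (jumpsBefore (m c) (t c)).map (fun x => x / r c) B =
      m c {z | (c, z) ∈ {p : γ × (ℝ × ℝ) | p.2.1 < t p.1 ∧ p.2.2 / r p.1 ∈ B}} := by
    intro c
    rw [Measure.map_apply (by fun_prop) hB,
      jumpsBefore_apply _ _ ((measurable_id'.div_const _) hB)]
    rfl
  simp only [h1]
  refine measurable_measure_of_isLocallyFinite ν hm hfin ?_
  refine (measurableSet_lt (f := fun p : γ × (ℝ × ℝ) => p.2.1) (g := fun p => t p.1)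
    (by fun_prop) (by fun_prop)).inter ?_
  exact measurableSet_preimage (f := fun p : γ × (ℝ × ℝ) => p.2.2 / r p.1) (by fun_prop) hB

theorem measurable_selfNormalize_jumpsBefore :
    Measurable fun c => selfNormalize (jumpsBefore (m c) (t c)) :=
  measurable_map_div_jumpsBefore ν hm hfin ht
    (measurable_totalSize_jumpsBefore ν hm hfin ht).ennreal_toReal

include hT in
theorem measurable_completion_jumpsBefore :
    Measurable fun c => completion (T c) (jumpsBefore (m c) (t c)) := by
  have h1 := measurable_map_div_jumpsBefore ν hm hfin ht hT
  have h2 := (measurable_totalSize_jumpsBefore ν hm hfin ht).ennreal_toReal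
  have h3 : Measurable fun c =>
      Measure.dirac ((T c - (totalSize (jumpsBefore (m c) (t c))).toReal) / T c) :=
    Measure.measurable_dirac.comp ((hT.sub h2).div hT)
  refine Measure.measurable_of_measurable_coe _ fun B hB => ?_
  exact ((Measure.measurable_coe hB).comp h1).add ((Measure.measurable_coe hB).comp h3)

end Measurability

theorem measurableSet_straddles {γ : Type*} [MeasurableSpace γ] (ν : Measure (ℝ × ℝ))
    [SigmaFinite ν] {m : γ → Measure (ℝ × ℝ)} (hm : Measurable m)
    (hfin : ∀ c, IsLocallyFinite ν (m c)) {T : γ → ℝ} (hT : Measurable T) {z : γ → ℝ × ℝ}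
    (hz : Measurable z) : MeasurableSet {c | Straddles (T c) (m c) (z c)} := by
  have h1 := measurable_totalSize_jumpsBefore ν hm hfin (measurable_fst.comp hz)
  exact (measurableSet_lt h1 hT.ennreal_ofReal).inter (measurableSet_lt hT.ennreal_ofReal
    (h1.add (measurable_snd.comp hz).ennreal_ofReal))

open Classical in
/-- The contribution of the jump `z` to the functional `F` of the completed jumps before the
passage across `T`. -/
noncomputable def straddleTerm (F : Measure ℝ → ℝ≥0∞) (T : ℝ) (m : Measure (ℝ × ℝ))
    (z : ℝ × ℝ) : ℝ≥0∞ :=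
  if Straddles T m z then F (completion T (jumpsBefore m z.1)) else 0

theorem straddleTerm_of_not {F : Measure ℝ → ℝ≥0∞} {T : ℝ} {m : Measure (ℝ × ℝ)} {z : ℝ × ℝ}
    (h : ¬ Straddles T m z) : straddleTerm F T m z = 0 := if_neg h

theorem measurable_straddleTerm {γ : Type*} [MeasurableSpace γ] (ν : Measure (ℝ × ℝ))
    [SigmaFinite ν] {m : γ → Measure (ℝ × ℝ)} (hm : Measurable m)
    (hfin : ∀ c, IsLocallyFinite ν (m c)) {T : γ → ℝ} (hT : Measurable T) {z : γ → ℝ × ℝ}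
    (hz : Measurable z) {F : Measure ℝ → ℝ≥0∞} (hF : Measurable F) :
    Measurable fun c => straddleTerm F (T c) (m c) (z c) := by
  classical
  exact Measurable.ite (measurableSet_straddles ν hm hfin hT hz)
    (hF.comp (measurable_completion_jumpsBefore ν hm hfin (measurable_fst.comp hz) hT))
    measurable_const

theorem jumpsBefore_add_dirac_of_lt (m : Measure (ℝ × ℝ)) {t : ℝ} {z : ℝ × ℝ} (h : z.1 < t) :
    jumpsBefore (m + Measure.dirac z) t = jumpsBefore m t + Measure.dirac z.2 := by
  ext B hB
  have hs : MeasurableSet {w : ℝ × ℝ | w.1 < t ∧ w.2 ∈ B} :=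
    (measurableSet_lt measurable_fst measurable_const).inter (measurable_snd hB)
  simp only [jumpsBefore_apply _ _ hB, Measure.add_apply, Measure.dirac_apply' _ hs,
    Measure.dirac_apply' _ hB]
  congr 1
  by_cases hz : z.2 ∈ B
  · rw [indicator_of_mem hz,
      indicator_of_mem (show z ∈ {w : ℝ × ℝ | w.1 < t ∧ w.2 ∈ B} from ⟨h, hz⟩)]
    rfl
  · rw [indicator_of_notMem hz, indicator_of_notMem (fun h' => hz h'.2)]

theorem jumpsBefore_add_dirac_of_ge (m : Measure (ℝ × ℝ)) {t : ℝ} {z : ℝ × ℝ} (h : t ≤ z.1) :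
    jumpsBefore (m + Measure.dirac z) t = jumpsBefore m t := by
  ext B hB
  have hs : MeasurableSet {w : ℝ × ℝ | w.1 < t ∧ w.2 ∈ B} :=
    (measurableSet_lt measurable_fst measurable_const).inter (measurable_snd hB)
  simp only [jumpsBefore_apply _ _ hB, Measure.add_apply, Measure.dirac_apply' _ hs]
  simp [h.not_gt]

/-- Only the strictly earlier jumps enter the term of a jump, so adding the jump does not affect it. -/
theorem straddleTerm_add_dirac (F : Measure ℝ → ℝ≥0∞) (T : ℝ) (m : Measure (ℝ × ℝ))
    (z : ℝ × ℝ) : straddleTerm F T (m + Measure.dirac z) z = straddleTerm F T m z := by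
  have h : Straddles T (m + Measure.dirac z) z ↔ Straddles T m z := by
    rw [Straddles, Straddles, jumpsBefore_add_dirac_of_ge m le_rfl]
  by_cases h' : Straddles T m z
  · rw [straddleTerm, straddleTerm, if_pos (h.2 h'), if_pos h',
      jumpsBefore_add_dirac_of_ge m le_rfl]
  · rw [straddleTerm, straddleTerm, if_neg (mt h.1 h'), if_neg h']

theorem totalSize_add_dirac (j : Measure ℝ) (a : ℝ) :
    totalSize (j + Measure.dirac a) = totalSize j + ENNReal.ofReal a := by
  rw [totalSize, lintegral_add_measure, lintegral_dirac]
  rfl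

/-- Adding a point of size `a` and normalizing amounts to completing to the new total. -/
theorem selfNormalize_add_dirac {j : Measure ℝ} (hj : totalSize j ≠ ∞) {a : ℝ} (ha : 0 ≤ a) :
    selfNormalize (j + Measure.dirac a) = completion ((totalSize j).toReal + a) j := by
  rw [selfNormalize_eq, totalSize_add_dirac, ENNReal.toReal_add hj ENNReal.ofReal_ne_top,
    ENNReal.toReal_ofReal ha, Measure.map_add _ _ (by fun_prop), Measure.map_dirac' (by fun_prop),
    completion, add_sub_cancel_left]

theorem jumpsBefore_map_scaling (m : Measure (ℝ × ℝ)) (t : ℝ) {a : ℝ} (ha : 0 < a) (b : ℝ) :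
    jumpsBefore (m.map (scaling a b)) (a * t) = (jumpsBefore m t).map (b * ·) := by
  ext B hB
  rw [jumpsBefore_apply _ _ hB, Measure.map_apply (by fun_prop) hB,
    jumpsBefore_apply _ _ (measurable_const_mul b hB), Measure.map_apply (measurable_scaling a b)]
  · congr 1
    ext z
    simp [scaling, ha]
  · exact (measurableSet_lt measurable_fst measurable_const).inter (measurable_snd hB)

theorem totalSize_map_mul (j : Measure ℝ) {b : ℝ} (hb : 0 ≤ b) :
    totalSize (j.map (b * ·)) = ENNReal.ofReal b * totalSize j := by
  rw [totalSize, totalSize, lintegral_map (by fun_prop) (by fun_prop)]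
  simp only [ENNReal.ofReal_mul hb]
  rw [lintegral_const_mul _ (by fun_prop)]

theorem selfNormalize_map_mul (j : Measure ℝ) {b : ℝ} (hb : 0 < b) :
    selfNormalize (j.map (b * ·)) = selfNormalize j := by
  rw [selfNormalize_eq, selfNormalize_eq, totalSize_map_mul _ hb.le,
    Measure.map_map (by fun_prop) (by fun_prop), ENNReal.toReal_mul, ENNReal.toReal_ofReal hb.le]
  congr 1
  ext x
  exact mul_div_mul_left _ _ hb.ne'

theorem completion_map_mul (T : ℝ) (j : Measure ℝ) {b : ℝ} (hb : 0 < b) :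
    completion T (j.map (b * ·)) = completion (T / b) j := by
  rw [completion, completion, totalSize_map_mul _ hb.le,
    Measure.map_map (by fun_prop) (by fun_prop), ENNReal.toReal_mul, ENNReal.toReal_ofReal hb.le]
  congr 2
  · ext x
    simp only [Function.comp_apply]
    field_simp
  · field_simp

theorem straddles_map_scaling (T : ℝ) (m : Measure (ℝ × ℝ)) (z : ℝ × ℝ) {a b : ℝ} (ha : 0 < a)
    (hb : 0 < b) : Straddles T (m.map (scaling a b)) (scaling a b z) ↔ Straddles (T / b) m z := by
  have hT : ENNReal.ofReal T = ENNReal.ofReal b * ENNReal.ofReal (T / b) := by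
    rw [← ENNReal.ofReal_mul hb.le, mul_div_cancel₀ _ hb.ne']
  have hb0 : ENNReal.ofReal b ≠ 0 := by simpa using hb
  simp only [Straddles, scaling]
  rw [jumpsBefore_map_scaling _ _ ha, totalSize_map_mul _ hb.le, hT, ENNReal.ofReal_mul hb.le,
    ← mul_add, ENNReal.mul_lt_mul_iff_right hb0 ENNReal.ofReal_ne_top,
    ENNReal.mul_lt_mul_iff_right hb0 ENNReal.ofReal_ne_top]

theorem straddleTerm_map_scaling (F : Measure ℝ → ℝ≥0∞) (T : ℝ) (m : Measure (ℝ × ℝ))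
    (z : ℝ × ℝ) {a b : ℝ} (ha : 0 < a) (hb : 0 < b) :
    straddleTerm F T (m.map (scaling a b)) (scaling a b z) = straddleTerm F (T / b) m z := by
  have h := straddles_map_scaling T m z ha hb
  by_cases h' : Straddles (T / b) m z
  · rw [straddleTerm, straddleTerm, if_pos (h.2 h'), if_pos h',
      show (scaling a b z).1 = a * z.1 from rfl, jumpsBefore_map_scaling _ _ ha,
      completion_map_mul _ _ hb]
  · rw [straddleTerm, straddleTerm, if_neg (mt h.1 h'), if_neg h']

/-- The change of variables `T = x + a` at the heart of the identity. It uses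
`μ_α(a, ∞) da = α⁻¹ a μ_α(da)`: the overshooting jump, once cut at the level `T`, is a size-biased
jump. -/
theorem lintegral_straddling_jump {α K : ℝ} (hα : 0 < α) (hK : 0 < K) (x : ℝ≥0∞) {R : ℝ → ℝ≥0∞}
    (hR : Measurable R) :
    ∫⁻ T in Ioo 0 1, ∫⁻ p, (if x < ENNReal.ofReal T ∧ ENNReal.ofReal T < x + ENNReal.ofReal p
      then R T else 0) ∂(stableLevyMeasure α K) =
    ENNReal.ofReal α⁻¹ * ∫⁻ a, ENNReal.ofReal a *
      (if x + ENNReal.ofReal a < 1 then R (x.toReal + a) else 0) ∂(stableLevyMeasure α K) := by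
  by_cases hx : x = ∞
  · simp [hx]
  lift x to ℝ≥0 using hx
  have h1 : ∀ T ∈ Ioo (0 : ℝ) 1, ∫⁻ p, (if (x : ℝ≥0∞) < ENNReal.ofReal T ∧
      ENNReal.ofReal T < x + ENNReal.ofReal p then R T else 0) ∂(stableLevyMeasure α K) =
      (Ioi (x : ℝ)).indicator (fun T => ENNReal.ofReal (K * (T - x) ^ (-α)) * R T) T := by
    intro T hT
    have e : (x : ℝ≥0∞) < ENNReal.ofReal T ↔ (x : ℝ) < T := by
      rw [← ENNReal.ofReal_coe_nnreal, ENNReal.ofReal_lt_ofReal_iff hT.1]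
    by_cases hxT : (x : ℝ) < T
    · have e2 : ∀ p, (if (x : ℝ≥0∞) < ENNReal.ofReal T ∧
          ENNReal.ofReal T < x + ENNReal.ofReal p then R T else 0) =
          (Ioi (T - x)).indicator (fun _ => R T) p := by
        intro p
        rw [indicator_apply]
        refine if_congr ?_ rfl rfl
        rw [e, and_iff_right hxT, mem_Ioi]
        constructor
        · intro h
          by_contra hp
          push Not at hp
          have : x + ENNReal.ofReal p ≤ ENNReal.ofReal T := by
            rw [← ENNReal.ofReal_coe_nnreal]
            refine (add_le_add_right (ENNReal.ofReal_le_ofReal hp) _).trans ?_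
            rw [← ENNReal.ofReal_add x.coe_nonneg (by linarith)]
            exact ENNReal.ofReal_le_ofReal (by linarith)
          exact absurd h this.not_gt
        · intro h
          have hp : 0 < p := by linarith
          rw [← ENNReal.ofReal_coe_nnreal, ← ENNReal.ofReal_add x.coe_nonneg hp.le]
          exact (ENNReal.ofReal_lt_ofReal_iff (by linarith)).2 (by linarith)
      simp only [e2]
      rw [lintegral_indicator measurableSet_Ioi, setLIntegral_const,
        stableLevyMeasure_Ioi hα hK (by linarith), indicator_of_mem (show T ∈ Ioi (x : ℝ) from hxT),
        mul_comm]
    · simp [e, hxT]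
  rw [setLIntegral_congr_fun measurableSet_Ioo h1, ← lintegral_indicator measurableSet_Ioo,
    ← lintegral_add_left_eq_self _ (x : ℝ), lintegral_stableLevyMeasure,
    ← lintegral_const_mul' _ _ ENNReal.ofReal_ne_top, ← lintegral_indicator measurableSet_Ioi]
  · refine lintegral_congr fun a => ?_
    by_cases ha : 0 < a
    · rw [indicator_of_mem (show a ∈ Ioi (0 : ℝ) from ha)]
      have hxa : (x : ℝ) + a ∈ Ioi (x : ℝ) := by simpa using ha
      have e3 : (x : ℝ≥0∞) + ENNReal.ofReal a < 1 ↔ (x : ℝ) + a ∈ Ioo (0 : ℝ) 1 := by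
        rw [← ENNReal.ofReal_coe_nnreal, ← ENNReal.ofReal_add x.coe_nonneg ha.le,
          ENNReal.ofReal_lt_one]
        exact ⟨fun h => ⟨add_pos_of_nonneg_of_pos x.coe_nonneg ha, h⟩, fun h => h.2⟩
      by_cases h : (x : ℝ) + a ∈ Ioo (0 : ℝ) 1
      · rw [indicator_of_mem h, indicator_of_mem hxa, if_pos (e3.2 h), add_sub_cancel_left,
          ENNReal.coe_toReal, ← mul_assoc, ← mul_assoc, ← ENNReal.ofReal_mul (by positivity),
          ← ENNReal.ofReal_mul (by positivity)]
        congr 2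
        have : a ^ (-α) = a ^ (-α - 1) * a := by
          nth_rw 3 [← Real.rpow_one a]
          rw [← Real.rpow_add ha]
          ring_nf
        rw [this]
        field_simp
      · rw [indicator_of_notMem h, if_neg (fun h' => h (e3.1 h'))]
        simp
    · have hxa : (x : ℝ) + a ∉ Ioi (x : ℝ) := by simpa using ha
      rw [indicator_of_notMem (show a ∉ Ioi (0 : ℝ) from ha), indicator_apply,
        indicator_of_notMem hxa, ite_self]
  · refine ENNReal.measurable_ofReal.mul (Measurable.ite ?_ ?_ measurable_const)
    · exact measurableSet_lt (by fun_prop) measurable_const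
    · exact hR.comp (by fun_prop)

/-! ### The stable subordinator at a fixed time -/

section

variable {Ω : Type*} [MeasurableSpace Ω] {α K : ℝ} {N : Ω → Measure (ℝ × ℝ)} {P : Measure Ω}

open Filter Topology in
theorem ae_totalSize_jumpsBefore_lt_top [IsProbabilityMeasure P] (hα : α ∈ Ioo (0 : ℝ) 1)
    (hK : 0 < K)
    (hN : IsPoissonPointProcess N (stableIntensity α K) P)
    (hfin : ∀ ω, IsLocallyFinite (stableIntensity α K) (N ω)) (t : ℝ) :
    ∀ᵐ ω ∂P, totalSize (jumpsBefore (N ω) t) < ∞ := by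
  have hsq : ∀ M : ℝ, MeasurableSet (Iio t ×ˢ Ioi M) := fun M =>
    measurableSet_Iio.prod measurableSet_Ioi
  have hsq' : ∀ M : ℝ, MeasurableSet (Iio t ×ˢ Iic M) := fun M =>
    measurableSet_Iio.prod measurableSet_Iic
  -- the jumps of size at most `M` have a finite expected sum
  have h1 : ∀ᵐ ω ∂P, ∀ M : ℕ, ∫⁻ z in Iio t ×ˢ Iic (M : ℝ), ENNReal.ofReal z.2 ∂(N ω) < ∞ := by
    refine ae_all_iff.2 fun M => ?_
    have hg : Measurable ((Iio t ×ˢ Iic (M : ℝ)).indicator fun z : ℝ × ℝ => ENNReal.ofReal z.2) :=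
      Measurable.indicator (by fun_prop) (hsq' M)
    have hmeas : Measurable fun ω => ∫⁻ z in Iio t ×ˢ Iic (M : ℝ), ENNReal.ofReal z.2 ∂(N ω) := by
      simp only [← lintegral_indicator (hsq' M)]
      exact measurable_lintegral_of_isLocallyFinite _ hN.measurable hfin (hg.comp measurable_snd)
    refine ae_lt_top hmeas ?_
    have := hN.mecke hfin (f := fun z _ => (Iio t ×ˢ Iic (M : ℝ)).indicator
      (fun z : ℝ × ℝ => ENNReal.ofReal z.2) z) (hg.comp measurable_fst)
    simp only [lintegral_indicator (hsq' M)] at this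
    rw [this]
    simp only [lintegral_const, measure_univ, mul_one]
    rw [lintegral_indicator (hsq' M), ← Measure.prod_restrict,
      lintegral_prod_symm _ (by fun_prop)]
    simp only [lintegral_const, Measure.restrict_apply_univ]
    rw [lintegral_mul_const _ (by fun_prop)]
    refine ENNReal.mul_ne_top (lintegral_Iic_stableLevyMeasure_lt_top hα hK M).ne ?_
    rw [Measure.restrict_apply measurableSet_Iio, Iio_inter_Ioi, Real.volume_Ioo]
    exact ENNReal.ofReal_ne_top
  -- almost surely there are no jumps above some level
  have h2 : ∀ᵐ ω ∂P, ∃ M : ℕ, N ω (Iio t ×ˢ Ioi (M : ℝ)) = 0 := by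
    have hlim : Tendsto (fun M : ℕ => ENNReal.ofReal t * ENNReal.ofReal (K * (M : ℝ) ^ (-α)))
        atTop (𝓝 0) := by
      have e1 : Tendsto (fun M : ℕ => K * (M : ℝ) ^ (-α)) atTop (𝓝 0) := by
        simpa using ((tendsto_rpow_neg_atTop hα.1).comp tendsto_natCast_atTop_atTop).const_mul K
      have e2 := ENNReal.Tendsto.const_mul (a := ENNReal.ofReal t) (ENNReal.tendsto_ofReal e1)
        (Or.inr ENNReal.ofReal_ne_top)
      simpa using e2
    rw [ae_iff]
    refine le_antisymm (ge_of_tendsto hlim ?_) (zero_le)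
    filter_upwards [eventually_gt_atTop 0] with M hM
    have hM' : (0 : ℝ) < M := by exact_mod_cast hM
    have hν := stableIntensity_Iio_prod_Ioi hα.1 hK t hM'
    have hν' : stableIntensity α K (Iio t ×ˢ Ioi (M : ℝ)) ≠ ∞ := by
      rw [hν]; exact ENNReal.mul_ne_top ENNReal.ofReal_ne_top ENNReal.ofReal_ne_top
    have hA : MeasurableSet {ω | N ω (Iio t ×ˢ Ioi (M : ℝ)) = 0} :=
      hN.measurable_apply (hsq M) (measurableSet_singleton 0)
    rw [← hν]
    set q := stableIntensity α K (Iio t ×ˢ Ioi (M : ℝ)) with hq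
    calc
      _ ≤ P {ω | N ω (Iio t ×ˢ Ioi (M : ℝ)) = 0}ᶜ :=
        measure_mono fun ω (hω : ¬ ∃ M : ℕ, N ω (Iio t ×ˢ Ioi (M : ℝ)) = 0) h => hω ⟨M, h⟩
      _ = 1 - ENNReal.ofReal (Real.exp (-q.toReal)) := by
        rw [prob_compl_eq_one_sub hA, hN.measure_apply_eq_zero (hsq M) hν']
      _ ≤ q := by
        rw [tsub_le_iff_right]
        nth_rw 1 [← ENNReal.ofReal_toReal hν', ← ENNReal.ofReal_one]
        rw [← ENNReal.ofReal_add ENNReal.toReal_nonneg (Real.exp_nonneg _)]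
        refine ENNReal.ofReal_le_ofReal ?_
        linarith [Real.add_one_le_exp (-q.toReal)]
  filter_upwards [h1, h2] with ω h1 h2
  obtain ⟨M, hM⟩ := h2
  have hU : Iio t ×ˢ (univ : Set ℝ) = Iio t ×ˢ Iic (M : ℝ) ∪ Iio t ×ˢ Ioi (M : ℝ) := by
    rw [← prod_union, Iic_union_Ioi]
  rw [totalSize_jumpsBefore, lintegral_indicator (measurableSet_Iio.prod MeasurableSet.univ), hU]
  refine (lintegral_union_le _ _ _).trans_lt (ENNReal.add_lt_top.2 ⟨h1 M, ?_⟩)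
  rw [Measure.restrict_eq_zero.2 hM, lintegral_zero_measure]
  exact ENNReal.zero_lt_top

open Filter Topology in
/-- There are almost surely jumps before time `t`, because the intensity of the jumps of size `> u`
tends to infinity as `u` tends to zero. -/
theorem ae_totalSize_jumpsBefore_pos (hα : α ∈ Ioo (0 : ℝ) 1) (hK : 0 < K)
    (hN : IsPoissonPointProcess N (stableIntensity α K) P) {t : ℝ} (ht : 0 < t) :
    ∀ᵐ ω ∂P, 0 < totalSize (jumpsBefore (N ω) t) := by
  have hsq : ∀ u : ℝ, MeasurableSet (Iio t ×ˢ Ioi u) := fun u =>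
    measurableSet_Iio.prod measurableSet_Ioi
  have h1 : ∀ u : ℝ, 0 < u → P {ω | ¬ 0 < totalSize (jumpsBefore (N ω) t)} ≤
      ENNReal.ofReal (Real.exp (-(t * (K * u ^ (-α))))) := by
    intro u hu
    have hν := stableIntensity_Iio_prod_Ioi hα.1 hK t hu
    have hν' : stableIntensity α K (Iio t ×ˢ Ioi u) ≠ ∞ := by
      rw [hν]; exact ENNReal.mul_ne_top ENNReal.ofReal_ne_top ENNReal.ofReal_ne_top
    have h2 := hN.measure_apply_eq_zero (hsq u) hν'
    rw [hν, ENNReal.toReal_mul, ENNReal.toReal_ofReal ht.le,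
      ENNReal.toReal_ofReal (by positivity)] at h2
    rw [← h2]
    refine measure_mono fun ω hω => ?_
    simp only [mem_ofPred_eq, not_lt, nonpos_iff_eq_zero] at hω ⊢
    rw [totalSize_jumpsBefore, lintegral_eq_zero_iff
      (Measurable.indicator (by fun_prop) (measurableSet_Iio.prod MeasurableSet.univ))] at hω
    refine measure_mono_null (fun z hz => ?_) (ae_iff.1 hω)
    have hz2 : 0 < z.2 := hu.trans hz.2
    simp [indicator_apply, hz.1.out, hz2]
  rw [ae_iff]
  have hlim : Tendsto (fun n : ℕ => ENNReal.ofReal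
      (Real.exp (-(t * (K * (((n : ℝ) + 1)⁻¹) ^ (-α)))))) atTop (𝓝 0) := by
    have e1 : Tendsto (fun n : ℕ => t * (K * (((n : ℝ) + 1)⁻¹) ^ (-α))) atTop atTop := by
      refine Tendsto.const_mul_atTop ht (Tendsto.const_mul_atTop hK ?_)
      have e2 : Tendsto (fun n : ℕ => ((n : ℝ) + 1) ^ α) atTop atTop :=
        (tendsto_rpow_atTop hα.1).comp (tendsto_atTop_add_const_right _ 1
          tendsto_natCast_atTop_atTop)
      refine e2.congr fun n => ?_
      have : (0 : ℝ) < (n : ℝ) + 1 := by positivity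
      rw [Real.rpow_neg (by positivity), Real.inv_rpow this.le, inv_inv]
    have e3 := ENNReal.tendsto_ofReal (Real.tendsto_exp_neg_atTop_nhds_zero.comp e1)
    simpa using e3
  exact le_antisymm (ge_of_tendsto' hlim fun n => h1 _ (by positivity)) (zero_le)

/-- With `x = τ_{1-}` and `c = F(η(1-))`, this integral over the time variable undoes the size bias:
the substitution `v = t ^ α⁻¹ x` turns it into `∫ 1{v < 1} c dv`. -/
theorem lintegral_rpow_cutoff (hα : 0 < α) {x : ℝ≥0∞} (hx0 : 0 < x) (hx : x < ∞) (c : ℝ≥0∞) :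
    ∫⁻ t in Ioi (0 : ℝ), ENNReal.ofReal α⁻¹ * (ENNReal.ofReal t⁻¹ *
      (ENNReal.ofReal (t ^ α⁻¹) * x * if ENNReal.ofReal (t ^ α⁻¹) * x < 1 then c else 0)) = c := by
  lift x to ℝ≥0 using hx.ne
  have hr : (0 : ℝ) < x := by exact_mod_cast hx0
  obtain ⟨r, hrdef⟩ : ∃ r : ℝ, r = x := ⟨_, rfl⟩
  rw [← hrdef] at hr
  have hy : 0 < r ^ (-α) := Real.rpow_pos_of_pos hr _
  have h1 : ∀ t ∈ Ioi (0 : ℝ), ENNReal.ofReal α⁻¹ * (ENNReal.ofReal t⁻¹ *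
      (ENNReal.ofReal (t ^ α⁻¹) * x * if ENNReal.ofReal (t ^ α⁻¹) * x < 1 then c else 0)) =
      (Iio (r ^ (-α))).indicator (fun t => ENNReal.ofReal (α⁻¹ * r * t ^ (α⁻¹ - 1)) * c) t := by
    intro t ht
    have ht' : 0 < t := ht
    have e1 : ENNReal.ofReal (t ^ α⁻¹) * x = ENNReal.ofReal (t ^ α⁻¹ * r) := by
      rw [ENNReal.ofReal_mul (by positivity), hrdef, ENNReal.ofReal_coe_nnreal]
    have e2 : t ^ α⁻¹ * r < 1 ↔ t < r ^ (-α) := by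
      rw [← lt_div_iff₀ hr, one_div, Real.rpow_neg hr.le, ← Real.inv_rpow hr.le,
        Real.rpow_inv_lt_iff_of_pos ht'.le (by positivity) hα]
    simp only [e1, ENNReal.ofReal_lt_one, e2, indicator_apply, mem_Iio]
    split_ifs
    · rw [← mul_assoc, ← mul_assoc, ← ENNReal.ofReal_mul (by positivity),
        ← ENNReal.ofReal_mul (by positivity)]
      congr 2
      rw [Real.rpow_sub_one ht'.ne']
      field_simp
    · simp
  rw [setLIntegral_congr_fun measurableSet_Ioi h1, setLIntegral_indicator measurableSet_Iio,
    Iio_inter_Ioi, lintegral_mul_const _ (by fun_prop)]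
  have hα' : 0 < α⁻¹ := inv_pos.2 hα
  have hi : IntegrableOn (fun t : ℝ => α⁻¹ * r * t ^ (α⁻¹ - 1)) (Ioo 0 (r ^ (-α))) := by
    refine Integrable.const_mul ?_ _
    exact (intervalIntegrable_iff_integrableOn_Ioo_of_le hy.le).1
      (intervalIntegral.intervalIntegrable_rpow' (by linarith))
  rw [← ofReal_integral_eq_lintegral_ofReal hi]
  · rw [integral_const_mul, ← integral_Ioc_eq_integral_Ioo, ← intervalIntegral.integral_of_le hy.le,
      integral_rpow (Or.inl (by linarith)), sub_add_cancel, Real.zero_rpow hα'.ne', sub_zero,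
      ← Real.rpow_mul hr.le, neg_mul, mul_inv_cancel₀ hα.ne', Real.rpow_neg_one]
    have : α⁻¹ * r * (r⁻¹ / α⁻¹) = 1 := by field_simp
    rw [this, ENNReal.ofReal_one, one_mul]
  · filter_upwards [ae_restrict_mem measurableSet_Ioo] with t ht
    have := ht.1
    change 0 ≤ α⁻¹ * r * t ^ (α⁻¹ - 1)
    positivity

/-- Self-similarity of the stable subordinator: the jump process is invariant in law when times are
multiplied by `b ^ α` and sizes by `b`. -/
theorem IsPoissonPointProcess.map_scaling_of_rpow_eq
    (hN : IsPoissonPointProcess N (stableIntensity α K) P) {a b : ℝ} (hb : 0 < b)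
    (hab : a = b ^ α) :
    IsPoissonPointProcess (fun ω => (N ω).map (scaling a b)) (stableIntensity α K) P := by
  have ha : 0 < a := hab ▸ Real.rpow_pos_of_pos hb α
  have := hN.map (measurable_scaling a b)
  rwa [map_scaling_stableIntensity _ _ ha hb, ← hab, ← mul_assoc, inv_mul_cancel₀ ha.ne',
    one_mul] at this

end

/-! ### The central identity -/

section

variable {Ω : Type*} [MeasurableSpace Ω] {α K : ℝ} {N : Ω → Measure (ℝ × ℝ)} {P : Measure Ω}
  [IsProbabilityMeasure P] {F : Measure ℝ → ℝ≥0∞}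

/-- By scaling, the law of the completed jumps before the passage across `T` does not depend on
`T`. -/
theorem lintegral_straddleTerm_eq_level_one
    (hN : IsPoissonPointProcess N (stableIntensity α K) P) (hF : Measurable F) {T : ℝ}
    (hT : 0 < T) :
    ∫⁻ ω, ∫⁻ z, straddleTerm F T (N ω) z ∂(N ω) ∂P =
      ∫⁻ ω, ∫⁻ z, straddleTerm F 1 (N ω) z ∂(N ω) ∂P := by
  set ν := stableIntensity α K with hν
  have hG : Measurable fun m => ∫⁻ z, straddleTerm F T (truncation ν m) z ∂(truncation ν m) := by
    refine measurable_lintegral_of_isLocallyFinite ν (measurable_truncation ν)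
      (isLocallyFinite_truncation ν) ?_
    exact measurable_straddleTerm ν (γ := Measure (ℝ × ℝ) × (ℝ × ℝ))
      (m := fun c => truncation ν c.1) ((measurable_truncation ν).comp measurable_fst)
      (fun c => isLocallyFinite_truncation ν c.1) measurable_const measurable_snd hF
  have hTα : 0 < T ^ α := Real.rpow_pos_of_pos hT α
  have hN' := hN.map_scaling_of_rpow_eq hT (rfl : T ^ α = T ^ α)
  rw [hN.lintegral_eq hN' (G := fun m => ∫⁻ z, straddleTerm F T m z ∂m) hG]
  refine lintegral_congr fun ω => ?_
  have hemb : MeasurableEmbedding (scaling (T ^ α) T) := by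
    have h1 := (Homeomorph.mulLeft₀ (T ^ α) hTα.ne').measurableEmbedding.prodMap
      (Homeomorph.mulLeft₀ T hT.ne').measurableEmbedding
    exact h1
  rw [hemb.lintegral_map]
  simp only [straddleTerm_map_scaling F T (N ω) _ hTα hT, div_self hT.ne']

/-- The sum of the jumps before time `t` is size-biased by the Mecke formula: reweighting by it
amounts to adding an independent point with the law of a jump. -/
theorem lintegral_lintegral_completion (hN : IsPoissonPointProcess N (stableIntensity α K) P)
    (hfin : ∀ ω, IsLocallyFinite (stableIntensity α K) (N ω)) (hF : Measurable F) {t : ℝ}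
    (ht : 0 < t) :
    ∫⁻ ω, ∫⁻ a, ENNReal.ofReal a * (if totalSize (jumpsBefore (N ω) t) + ENNReal.ofReal a < 1 then
      F (completion ((totalSize (jumpsBefore (N ω) t)).toReal + a) (jumpsBefore (N ω) t)) else 0)
      ∂(stableLevyMeasure α K) ∂P =
    ENNReal.ofReal t⁻¹ * ∫⁻ ω, totalSize (jumpsBefore (N ω) t) *
      (if totalSize (jumpsBefore (N ω) t) < 1 then F (selfNormalize (jumpsBefore (N ω) t)) else 0)
      ∂P := by
  set ν := stableIntensity α K with hν
  let W : Measure ℝ → ℝ≥0∞ := fun j => if totalSize j < 1 then F (selfNormalize j) else 0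
  let V : ℝ → Ω → ℝ≥0∞ := fun a ω => ENNReal.ofReal a *
    (if totalSize (jumpsBefore (N ω) t) + ENNReal.ofReal a < 1 then
      F (completion ((totalSize (jumpsBefore (N ω) t)).toReal + a) (jumpsBefore (N ω) t)) else 0)
  have hVm : Measurable (Function.uncurry V) := by
    have h1 : Measurable fun p : ℝ × Ω => totalSize (jumpsBefore (N p.2) t) :=
      measurable_totalSize_jumpsBefore ν (hN.measurable.comp measurable_snd) (fun p => hfin p.2)
        measurable_const
    refine measurable_fst.ennreal_ofReal.mul (Measurable.ite ?_ (hF.comp ?_) measurable_const)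
    · exact measurableSet_lt (h1.add measurable_fst.ennreal_ofReal) measurable_const
    · exact measurable_completion_jumpsBefore ν (hN.measurable.comp measurable_snd)
        (fun p => hfin p.2) measurable_const (h1.ennreal_toReal.add measurable_fst)
  let f : ℝ × ℝ → Measure (ℝ × ℝ) → ℝ≥0∞ := fun z m =>
    (Iio t ×ˢ univ).indicator (fun z => ENNReal.ofReal z.2) z * W (jumpsBefore m t)
  have hind : Measurable ((Iio t ×ˢ univ).indicator fun z : ℝ × ℝ => ENNReal.ofReal z.2) :=
    Measurable.indicator (by fun_prop) (measurableSet_Iio.prod MeasurableSet.univ)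
  have hf : Measurable fun p : (ℝ × ℝ) × Measure (ℝ × ℝ) => f p.1 (truncation ν p.2) := by
    have h1 : Measurable fun c : (ℝ × ℝ) × Measure (ℝ × ℝ) => truncation ν c.2 :=
      (measurable_truncation ν).comp measurable_snd
    have h2 : ∀ c : (ℝ × ℝ) × Measure (ℝ × ℝ), IsLocallyFinite ν (truncation ν c.2) :=
      fun c => isLocallyFinite_truncation ν c.2
    refine (hind.comp measurable_fst).mul (Measurable.ite ?_ (hF.comp ?_) measurable_const)
    · exact measurableSet_lt (measurable_totalSize_jumpsBefore ν h1 h2 measurable_const)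
        measurable_const
    · exact measurable_selfNormalize_jumpsBefore ν h1 h2 measurable_const
  have hmecke := hN.mecke hfin hf
  have hL : ∀ ω, ∫⁻ z, f z (N ω) ∂(N ω) =
      totalSize (jumpsBefore (N ω) t) * W (jumpsBefore (N ω) t) := by
    intro ω
    simp only [f]
    rw [lintegral_mul_const _ hind, totalSize_jumpsBefore]
  have hR : ∀ z ω, f z (N ω + Measure.dirac z) = (Iio t).indicator (fun _ => V z.2 ω) z.1 := by
    intro z ω
    by_cases hz : z.1 < t
    · have hz' : z ∈ Iio t ×ˢ (univ : Set ℝ) := ⟨hz, mem_univ _⟩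
      simp only [f]
      rw [indicator_of_mem hz', indicator_of_mem (show z.1 ∈ Iio t from hz),
        jumpsBefore_add_dirac_of_lt _ hz]
      by_cases hz2 : 0 ≤ z.2
      · simp only [V, W]
        rw [totalSize_add_dirac]
        by_cases hx : totalSize (jumpsBefore (N ω) t) = ∞
        · simp [hx]
        · rw [selfNormalize_add_dirac hx hz2]
      · simp [V, ENNReal.ofReal_of_nonpos (not_le.1 hz2).le]
    · have hz' : z ∉ Iio t ×ˢ (univ : Set ℝ) := fun h => hz h.1
      simp only [f]
      rw [indicator_of_notMem hz', indicator_of_notMem (show z.1 ∉ Iio t from hz), zero_mul]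
  simp only [hL, hR] at hmecke
  have hVint : Measurable fun a => ∫⁻ ω, V a ω ∂P := hVm.lintegral_prod_right'
  have hpull : ∀ z : ℝ × ℝ, ∫⁻ ω, (Iio t).indicator (fun _ => V z.2 ω) z.1 ∂P =
      (Iio t).indicator 1 z.1 * ∫⁻ ω, V z.2 ω ∂P := by
    intro z
    by_cases hz : z.1 < t <;> simp [hz]
  simp only [hpull] at hmecke
  rw [hν, lintegral_prod _ (by
    exact (((measurable_one.indicator measurableSet_Iio).comp measurable_fst).mul
      (hVint.comp measurable_snd)).aemeasurable)] at hmecke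
  simp only [lintegral_const_mul _ hVint] at hmecke
  rw [lintegral_mul_const _ (measurable_one.indicator measurableSet_Iio),
    lintegral_indicator_one measurableSet_Iio, Measure.restrict_apply measurableSet_Iio,
    Iio_inter_Ioi, Real.volume_Ioo, sub_zero, lintegral_lintegral_swap hVm.aemeasurable] at hmecke
  have ht' : ENNReal.ofReal t⁻¹ * ENNReal.ofReal t = 1 := by
    rw [← ENNReal.ofReal_mul (by positivity), inv_mul_cancel₀ ht.ne', ENNReal.ofReal_one]
  change ∫⁻ ω, ∫⁻ a, V a ω ∂(stableLevyMeasure α K) ∂P = ENNReal.ofReal t⁻¹ *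
    ∫⁻ ω, totalSize (jumpsBefore (N ω) t) * W (jumpsBefore (N ω) t) ∂P
  rw [hmecke, ← mul_assoc, ht', one_mul]

/-- By scaling, the jumps before time `t` are distributed as `t ^ α⁻¹` times the jumps before time
one. -/
theorem lintegral_totalSize_mul_selfNormalize (hα : 0 < α)
    (hN : IsPoissonPointProcess N (stableIntensity α K) P) (hF : Measurable F) {t : ℝ}
    (ht : 0 < t) :
    ∫⁻ ω, totalSize (jumpsBefore (N ω) t) *
      (if totalSize (jumpsBefore (N ω) t) < 1 then F (selfNormalize (jumpsBefore (N ω) t)) else 0)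
      ∂P =
    ∫⁻ ω, ENNReal.ofReal (t ^ α⁻¹) * totalSize (jumpsBefore (N ω) 1) *
      (if ENNReal.ofReal (t ^ α⁻¹) * totalSize (jumpsBefore (N ω) 1) < 1 then
        F (selfNormalize (jumpsBefore (N ω) 1)) else 0) ∂P := by
  set ν := stableIntensity α K with hν
  have hb : 0 < t ^ α⁻¹ := Real.rpow_pos_of_pos ht _
  have hN' := hN.map_scaling_of_rpow_eq hb (Real.rpow_inv_rpow ht.le hα.ne').symm
  let H : Measure ℝ → ℝ≥0∞ := fun j =>
    totalSize j * if totalSize j < 1 then F (selfNormalize j) else 0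
  have hH : Measurable fun m => H (jumpsBefore (truncation ν m) t) := by
    have h2 := measurable_totalSize_jumpsBefore ν (measurable_truncation ν)
      (isLocallyFinite_truncation ν) (measurable_const (a := t))
    refine h2.mul (Measurable.ite (measurableSet_lt h2 measurable_const) (hF.comp ?_)
      measurable_const)
    exact measurable_selfNormalize_jumpsBefore ν (measurable_truncation ν)
      (isLocallyFinite_truncation ν) measurable_const
  refine (hN.lintegral_eq hN' (G := fun m => H (jumpsBefore m t)) hH).trans ?_
  refine lintegral_congr fun ω => ?_
  have := jumpsBefore_map_scaling (N ω) 1 ht (t ^ α⁻¹)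
  rw [mul_one] at this
  simp only [H, this, totalSize_map_mul _ hb.le, selfNormalize_map_mul _ hb]

/-- The central identity, `E F(ξ(T)) = E F(η(1))`, with `ξ(T)` expressed through the straddling
jump. -/
theorem lintegral_lintegral_straddleTerm (hα : α ∈ Ioo (0 : ℝ) 1) (hK : 0 < K)
    (hN : IsPoissonPointProcess N (stableIntensity α K) P)
    (hfin : ∀ ω, IsLocallyFinite (stableIntensity α K) (N ω)) (hF : Measurable F) {T : ℝ}
    (hT : 0 < T) :
    ∫⁻ ω, ∫⁻ z, straddleTerm F T (N ω) z ∂(N ω) ∂P =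
      ∫⁻ ω, F (selfNormalize (jumpsBefore (N ω) 1)) ∂P := by
  set ν := stableIntensity α K with hν
  have hS : ∀ {γ : Type} [MeasurableSpace γ] {ω : γ × Ω → Ω} {T : γ × Ω → ℝ} {z : γ × Ω → ℝ × ℝ},
      Measurable ω → Measurable T → Measurable z →
      Measurable fun c => straddleTerm F (T c) (N (ω c)) (z c) :=
    fun hω hT hz => measurable_straddleTerm ν (hN.measurable.comp hω) (fun c => hfin _) hT hz hF
  -- integrate over the level, and apply the Mecke formula
  have h1 : ∀ T : ℝ, ∫⁻ ω, ∫⁻ z, straddleTerm F T (N ω) z ∂(N ω) ∂P =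
      ∫⁻ t in Ioi 0, ∫⁻ ω, ∫⁻ p, straddleTerm F T (N ω) (t, p) ∂(stableLevyMeasure α K) ∂P := by
    intro T
    have hf : Measurable fun p : (ℝ × ℝ) × Measure (ℝ × ℝ) =>
        straddleTerm F T (truncation ν p.2) p.1 :=
      measurable_straddleTerm ν (m := fun p : (ℝ × ℝ) × Measure (ℝ × ℝ) => truncation ν p.2)
        ((measurable_truncation ν).comp measurable_snd)
        (fun c => isLocallyFinite_truncation ν c.2) measurable_const measurable_fst hF
    rw [hN.mecke hfin (f := fun z m => straddleTerm F T m z) hf]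
    simp only [straddleTerm_add_dirac]
    have h2 : Measurable fun c : (ℝ × ℝ) × Ω => straddleTerm F T (N c.2) c.1 :=
      hS measurable_snd measurable_const measurable_fst
    rw [hν, lintegral_prod _ h2.lintegral_prod_right'.aemeasurable]
    refine lintegral_congr fun t => ?_
    refine lintegral_lintegral_swap (f := fun p ω => straddleTerm F T (N ω) (t, p)) ?_
    exact (hS (γ := ℝ) (z := fun c => (t, c.1)) measurable_snd measurable_const
      (by fun_prop)).aemeasurable
  have h3 : ∫⁻ ω, ∫⁻ z, straddleTerm F T (N ω) z ∂(N ω) ∂P =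
      ∫⁻ T in Ioo (0 : ℝ) 1, ∫⁻ t in Ioi 0, ∫⁻ ω, ∫⁻ p,
        straddleTerm F T (N ω) (t, p) ∂(stableLevyMeasure α K) ∂P := by
    have : ∀ T' ∈ Ioo (0 : ℝ) 1, ∫⁻ t in Ioi 0, ∫⁻ ω, ∫⁻ p,
        straddleTerm F T' (N ω) (t, p) ∂(stableLevyMeasure α K) ∂P =
        ∫⁻ ω, ∫⁻ z, straddleTerm F T (N ω) z ∂(N ω) ∂P := by
      intro T' hT'
      rw [← h1, lintegral_straddleTerm_eq_level_one hN hF hT'.1,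
        lintegral_straddleTerm_eq_level_one hN hF hT]
    rw [setLIntegral_congr_fun measurableSet_Ioo this]
    simp
  have m1 : Measurable fun c : (ℝ × ℝ) × Ω =>
      ∫⁻ p, straddleTerm F c.1.1 (N c.2) (c.1.2, p) ∂(stableLevyMeasure α K) := by
    have : Measurable fun c : ((ℝ × ℝ) × Ω) × ℝ =>
        straddleTerm F c.1.1.1 (N c.1.2) (c.1.1.2, c.2) :=
      measurable_straddleTerm ν (m := fun c : ((ℝ × ℝ) × Ω) × ℝ => N c.1.2)
        (hN.measurable.comp (by fun_prop)) (fun c => hfin _) (by fun_prop) (by fun_prop) hF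
    exact this.lintegral_prod_right'
  have h4 : ∫⁻ ω, ∫⁻ z, straddleTerm F T (N ω) z ∂(N ω) ∂P =
      ∫⁻ t in Ioi 0, ∫⁻ ω, (∫⁻ T in Ioo (0 : ℝ) 1, ∫⁻ p,
        straddleTerm F T (N ω) (t, p) ∂(stableLevyMeasure α K)) ∂P := by
    rw [h3, lintegral_lintegral_swap m1.lintegral_prod_right'.aemeasurable]
    refine lintegral_congr fun t => ?_
    refine lintegral_lintegral_swap (f := fun T ω => ∫⁻ p,
      straddleTerm F T (N ω) (t, p) ∂(stableLevyMeasure α K)) ?_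
    exact (m1.comp (by fun_prop : Measurable fun c : ℝ × Ω => ((c.1, t), c.2))).aemeasurable
  have h5 : ∀ t ∈ Ioi (0 : ℝ), ∫⁻ ω, (∫⁻ T in Ioo (0 : ℝ) 1, ∫⁻ p,
        straddleTerm F T (N ω) (t, p) ∂(stableLevyMeasure α K)) ∂P =
      ∫⁻ ω, ENNReal.ofReal α⁻¹ * (ENNReal.ofReal t⁻¹ *
        (ENNReal.ofReal (t ^ α⁻¹) * totalSize (jumpsBefore (N ω) 1) *
        (if ENNReal.ofReal (t ^ α⁻¹) * totalSize (jumpsBefore (N ω) 1) < 1 then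
          F (selfNormalize (jumpsBefore (N ω) 1)) else 0))) ∂P := by
    intro t ht
    have e1 : ∀ ω, ∫⁻ T in Ioo (0 : ℝ) 1, ∫⁻ p,
        straddleTerm F T (N ω) (t, p) ∂(stableLevyMeasure α K) = ENNReal.ofReal α⁻¹ *
        ∫⁻ a, ENNReal.ofReal a * (if totalSize (jumpsBefore (N ω) t) + ENNReal.ofReal a < 1 then
        F (completion ((totalSize (jumpsBefore (N ω) t)).toReal + a) (jumpsBefore (N ω) t)) else 0)
        ∂(stableLevyMeasure α K) := by
      intro ω
      have hR : Measurable fun T => F (completion T (jumpsBefore (N ω) t)) :=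
        hF.comp (measurable_completion_jumpsBefore ν (m := fun _ : ℝ => N ω) measurable_const
          (fun _ => hfin ω) measurable_const measurable_id)
      rw [← lintegral_straddling_jump hα.1 hK (totalSize (jumpsBefore (N ω) t)) hR]
      refine lintegral_congr fun T => lintegral_congr fun p => ?_
      by_cases h : Straddles T (N ω) (t, p)
      · exact (if_pos h).trans (if_pos h).symm
      · exact (if_neg h).trans (if_neg h).symm
    simp only [e1]
    rw [lintegral_const_mul' _ _ ENNReal.ofReal_ne_top,
      lintegral_const_mul' _ _ ENNReal.ofReal_ne_top,
      lintegral_const_mul' _ _ ENNReal.ofReal_ne_top, lintegral_lintegral_completion hN hfin hF ht,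
      lintegral_totalSize_mul_selfNormalize hα.1 hN hF ht]
  rw [h4, setLIntegral_congr_fun measurableSet_Ioi h5, lintegral_lintegral_swap]
  · refine lintegral_congr_ae ?_
    filter_upwards [ae_totalSize_jumpsBefore_lt_top hα hK hN hfin 1,
      ae_totalSize_jumpsBefore_pos hα hK hN one_pos] with ω hω1 hω2
    exact lintegral_rpow_cutoff hα.1 hω2 hω1 _
  · have h6 : Measurable fun c : ℝ × Ω => totalSize (jumpsBefore (N c.2) 1) :=
      measurable_totalSize_jumpsBefore ν (hN.measurable.comp measurable_snd) (fun p => hfin p.2)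
        measurable_const
    have h7 : Measurable fun c : ℝ × Ω => selfNormalize (jumpsBefore (N c.2) 1) :=
      measurable_selfNormalize_jumpsBefore ν (hN.measurable.comp measurable_snd)
        (fun p => hfin p.2) measurable_const
    have h8 : Measurable fun c : ℝ × Ω =>
        ENNReal.ofReal (c.1 ^ α⁻¹) * totalSize (jumpsBefore (N c.2) 1) :=
      (by fun_prop : Measurable fun c : ℝ × Ω => ENNReal.ofReal (c.1 ^ α⁻¹)).mul h6
    refine Measurable.aemeasurable (Measurable.const_mul (Measurable.mul (by fun_prop)
      (h8.mul (Measurable.ite ?_ (hF.comp h7) measurable_const))) _)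
    exact measurableSet_lt h8 measurable_const

end

/-! ### The configuration at the passage across a level -/

theorem IsCountingMeasure.restrict {X : Type*} [MeasurableSpace X] {m : Measure X}
    (hm : IsCountingMeasure m) {A : Set X} (hA : MeasurableSet A) :
    IsCountingMeasure (m.restrict A) := by
  obtain ⟨I, x, rfl⟩ := hm
  refine ⟨{n | ∃ h : n ∈ I, x ⟨n, h⟩ ∈ A}, fun i => x ⟨i.1, i.2.1⟩, ?_⟩
  ext B hB
  rw [Measure.restrict_apply hB, Measure.sum_apply _ (hB.inter hA), Measure.sum_apply _ hB]
  let g : ℕ → ℝ≥0∞ := fun n => open Classical in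
    if h : n ∈ I then (B ∩ A).indicator 1 (x ⟨n, h⟩) else 0
  have e1 : ∀ i : I, Measure.dirac (x i) (B ∩ A) = g i.1 := by
    intro i
    rw [Measure.dirac_apply' _ (hB.inter hA)]
    simp [g]
  have e2 : ∀ i : {n | ∃ h : n ∈ I, x ⟨n, h⟩ ∈ A},
      Measure.dirac (x ⟨i.1, i.2.1⟩) B = g i.1 := by
    rintro ⟨n, h, hn⟩
    have hi : (B ∩ A).indicator (1 : X → ℝ≥0∞) (x ⟨n, h⟩) = B.indicator 1 (x ⟨n, h⟩) := by
      by_cases hB' : x ⟨n, h⟩ ∈ B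
      · rw [indicator_of_mem hB', indicator_of_mem (show x ⟨n, h⟩ ∈ B ∩ A from ⟨hB', hn⟩)]
      · rw [indicator_of_notMem hB', indicator_of_notMem fun h' => hB' h'.1]
    rw [Measure.dirac_apply' _ hB]
    simp [g, h, hi]
  simp only [e1, e2]
  rw [tsum_subtype I g, tsum_subtype {n | ∃ h : n ∈ I, x ⟨n, h⟩ ∈ A} g]
  refine tsum_congr fun n => ?_
  by_cases h : n ∈ I
  · by_cases hn : x ⟨n, h⟩ ∈ A <;> simp [g, h, hn]
  · simp [h]

theorem IsCountingMeasure.add_dirac {X : Type*} [MeasurableSpace X] {m : Measure X}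
    (hm : IsCountingMeasure m) (a : X) : IsCountingMeasure (m + Measure.dirac a) := by
  obtain ⟨I, x, rfl⟩ := hm
  -- the points of `m` are renumbered so that the number `0` becomes available
  refine ⟨{n | ∀ k, n = k + 1 → k ∈ I},
    fun i => match i with
      | ⟨0, _⟩ => a
      | ⟨k + 1, h⟩ => x ⟨k, h k rfl⟩, ?_⟩
  ext B hB
  rw [Measure.add_apply, Measure.sum_apply _ hB, Measure.sum_apply _ hB]
  let g : ℕ → ℝ≥0∞ := fun n => open Classical in
    if h : n ∈ I then Measure.dirac (x ⟨n, h⟩) B else 0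
  let g' : ℕ → ℝ≥0∞ := fun n => match n with
    | 0 => Measure.dirac a B
    | k + 1 => g k
  have e1 : ∀ i : I, Measure.dirac (x i) B = g i.1 := by
    intro i
    simp [g]
  have e2 : ∀ i : {n | ∀ k, n = k + 1 → k ∈ I}, Measure.dirac (match i with
      | ⟨0, _⟩ => a
      | ⟨k + 1, h⟩ => x ⟨k, h k rfl⟩) B = g' i.1 := by
    rintro ⟨_ | k, h⟩
    · rfl
    · have hk := h k rfl
      simp [g', g, hk]
  refine Eq.trans ?_ (tsum_congr e2).symm
  simp only [e1]
  rw [tsum_subtype I g, tsum_subtype {n | ∀ k, n = k + 1 → k ∈ I} g',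
    tsum_eq_zero_add' (f := {n | ∀ k, n = k + 1 → k ∈ I}.indicator g') ENNReal.summable, add_comm]
  congr 1
  · simp [g']
  · refine tsum_congr fun k => ?_
    by_cases hk : k ∈ I <;> simp [g', hk]

theorem mem_massPartitions {q : Measure ℝ} (hq : IsCountingMeasure q) (h0 : q (Iic 0) = 0)
    (h1 : totalSize q = 1) : q ∈ massPartitions := by
  refine ⟨hq, h0, fun u hu => ?_, h1⟩
  have h2 := mul_meas_ge_le_lintegral (μ := q) ENNReal.measurable_ofReal (ENNReal.ofReal u)
  change ENNReal.ofReal u * _ ≤ totalSize q at h2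
  rw [h1] at h2
  have hu' : ENNReal.ofReal u ≠ 0 := by simpa using hu
  refine lt_of_le_of_lt (measure_mono fun x hx => ?_)
    (ENNReal.lt_top_of_mul_ne_top_right (h2.trans_lt ENNReal.one_lt_top).ne hu')
  exact ENNReal.ofReal_le_ofReal (le_of_lt hx)

theorem map_div_Iic {j : Measure ℝ} (hj : j (Iic 0) = 0) {r : ℝ} (hr : 0 < r) :
    j.map (fun x => x / r) (Iic 0) = 0 := by
  rw [Measure.map_apply (by fun_prop) measurableSet_Iic]
  refine measure_mono_null (fun x hx => ?_) hj
  by_contra h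
  have : 0 < x / r := div_pos (not_le.1 h) hr
  exact absurd hx (not_le.2 this)

theorem totalSize_map_div (j : Measure ℝ) {r : ℝ} (hr : 0 < r) :
    totalSize (j.map fun x => x / r) = ENNReal.ofReal r⁻¹ * totalSize j := by
  rw [← totalSize_map_mul _ (inv_pos.2 hr).le]
  simp only [div_eq_inv_mul]

theorem selfNormalize_mem_massPartitions {j : Measure ℝ} (hj : IsCountingMeasure j)
    (h0 : j (Iic 0) = 0) (hpos : 0 < totalSize j) (hfin : totalSize j < ∞) :
    selfNormalize j ∈ massPartitions := by
  have hr : 0 < (totalSize j).toReal := ENNReal.toReal_pos hpos.ne' hfin.ne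
  rw [selfNormalize_eq]
  refine mem_massPartitions (hj.map (by fun_prop)) (map_div_Iic h0 hr) ?_
  rw [totalSize_map_div _ hr]
  nth_rw 2 [← ENNReal.ofReal_toReal hfin.ne]
  rw [← ENNReal.ofReal_mul (by positivity), inv_mul_cancel₀ hr.ne', ENNReal.ofReal_one]

theorem completion_mem_massPartitions {j : Measure ℝ} (hj : IsCountingMeasure j)
    (h0 : j (Iic 0) = 0) {T : ℝ} (hT : 0 < T) (hlt : totalSize j < ENNReal.ofReal T) :
    completion T j ∈ massPartitions := by
  have hfin : totalSize j ≠ ∞ := (hlt.trans ENNReal.ofReal_lt_top).ne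
  have hlt' : (totalSize j).toReal < T := (ENNReal.lt_ofReal_iff_toReal_lt hfin).1 hlt
  have hp : 0 < (T - (totalSize j).toReal) / T := div_pos (sub_pos.2 hlt') hT
  refine mem_massPartitions ((hj.map (by fun_prop)).add_dirac _) ?_ ?_
  · rw [completion, Measure.add_apply, map_div_Iic h0 hT, zero_add,
      Measure.dirac_apply' _ measurableSet_Iic, indicator_of_notMem (by simpa using hp)]
  · rw [completion, totalSize_add_dirac, totalSize_map_div _ hT]
    nth_rw 1 [← ENNReal.ofReal_toReal hfin]
    rw [← ENNReal.ofReal_mul (by positivity), ← ENNReal.ofReal_add (by positivity) hp.le]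
    have : T⁻¹ * (totalSize j).toReal + (T - (totalSize j).toReal) / T = 1 := by
      field_simp
      ring
    rw [this, ENNReal.ofReal_one]

theorem IsCountingMeasure.jumpsBefore {m : Measure (ℝ × ℝ)} (hm : IsCountingMeasure m) (t : ℝ) :
    IsCountingMeasure (jumpsBefore m t) :=
  (hm.restrict (measurableSet_Iio.prod MeasurableSet.univ)).map measurable_snd

theorem jumpsBefore_Iic {m : Measure (ℝ × ℝ)} (hm : m (Ioi 0 ×ˢ Ioi 0)ᶜ = 0) (t : ℝ) :
    jumpsBefore m t (Iic 0) = 0 := by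
  rw [jumpsBefore_apply _ _ measurableSet_Iic]
  refine measure_mono_null (fun z (hz : z.1 < t ∧ z.2 ≤ 0) => ?_) hm
  exact fun h : z ∈ Ioi (0 : ℝ) ×ˢ Ioi (0 : ℝ) => absurd hz.2 (not_le.2 h.2)

/-- If no jump happens at time `s`, the bound on the jump times may be taken strict. -/
theorem eta_eq_selfNormalize {m : Measure (ℝ × ℝ)} {s : ℝ} (hm : m {w | w.1 = s} = 0) :
    eta s m = selfNormalize (jumpsBefore m s) := by
  rw [eta, jumpsBefore]
  congr 2
  refine Measure.restrict_congr_set ?_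
  have : ∀ᵐ w ∂m, w.1 ≠ s := by
    rw [ae_iff]
    simpa using hm
  filter_upwards [this] with w hw
  apply propext
  change w ∈ Iic s ×ˢ univ ↔ w ∈ Iio s ×ˢ univ
  simp only [mem_prod, mem_univ, and_true, mem_Iic, mem_Iio]
  exact ⟨fun h => lt_of_le_of_ne h hw, le_of_lt⟩

theorem monotone_subordinator (m : Measure (ℝ × ℝ)) : Monotone (subordinator m) := fun _ _ h =>
  lintegral_mono_set (prod_mono (Iic_subset_Iic.2 h) le_rfl)

theorem totalSize_jumpsBefore_eq_setLIntegral (m : Measure (ℝ × ℝ)) (t : ℝ) :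
    totalSize (jumpsBefore m t) = ∫⁻ z in Iio t ×ˢ univ, ENNReal.ofReal z.2 ∂m := by
  rw [totalSize_jumpsBefore, lintegral_indicator (measurableSet_Iio.prod MeasurableSet.univ)]

theorem subordinator_le_totalSize_jumpsBefore (m : Measure (ℝ × ℝ)) {r t : ℝ} (h : r < t) :
    subordinator m r ≤ totalSize (jumpsBefore m t) := by
  rw [totalSize_jumpsBefore_eq_setLIntegral]
  exact lintegral_mono_set (prod_mono (Iic_subset_Iio.2 h) le_rfl)

/-- The left limit `τ(t-)` is the sum of the jumps at times `< t`. -/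
theorem leftLim_subordinator (m : Measure (ℝ × ℝ)) (t : ℝ) :
    Function.leftLim (subordinator m) t = totalSize (jumpsBefore m t) := by
  rw [(monotone_subordinator m).leftLim_eq_sSup]
  refine le_antisymm (sSup_le ?_) ?_
  · rintro _ ⟨r, hr, rfl⟩
    exact subordinator_le_totalSize_jumpsBefore m hr
  · have hU : Iio t ×ˢ (univ : Set ℝ) = ⋃ n : ℕ, Iic (t - 1 / ((n : ℝ) + 1)) ×ˢ univ := by
      rw [← iUnion_prod_const]
      congr 1
      ext r
      simp only [mem_Iio, mem_iUnion, mem_Iic]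
      constructor
      · intro h
        obtain ⟨n, hn⟩ := exists_nat_one_div_lt (sub_pos.2 h)
        exact ⟨n, by linarith⟩
      · rintro ⟨n, hn⟩
        have : (0 : ℝ) < 1 / ((n : ℝ) + 1) := by positivity
        linarith
    have hmono : Monotone fun n : ℕ => Iic (t - 1 / ((n : ℝ) + 1)) ×ˢ (univ : Set ℝ) := by
      intro i j h
      refine prod_mono (Iic_subset_Iic.2 (sub_le_sub_left ?_ _)) le_rfl
      exact one_div_le_one_div_of_le (by positivity) (by gcongr)
    rw [totalSize_jumpsBefore_eq_setLIntegral, hU,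
      setLIntegral_iUnion_of_directed _ hmono.directed_le]
    refine iSup_le fun n => le_sSup ⟨t - 1 / ((n : ℝ) + 1), ?_, rfl⟩
    have : (0 : ℝ) < 1 / ((n : ℝ) + 1) := by positivity
    simp only [mem_Iio]
    linarith

theorem add_le_subordinator {m : Measure (ℝ × ℝ)} {z : ℝ × ℝ} (hz : 1 ≤ m {z}) :
    totalSize (jumpsBefore m z.1) + ENNReal.ofReal z.2 ≤ subordinator m z.1 := by
  have hd : Disjoint (Iio z.1 ×ˢ (univ : Set ℝ)) {z} := by
    rw [disjoint_singleton_right]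
    exact fun h => (lt_irrefl z.1) h.1
  have hsub : Iio z.1 ×ˢ (univ : Set ℝ) ∪ {z} ⊆ Iic z.1 ×ˢ univ := by
    rintro w (hw | rfl)
    · exact ⟨(mem_Iio.1 hw.1).le, mem_univ _⟩
    · exact ⟨mem_Iic.2 le_rfl, mem_univ _⟩
  calc _ ≤ ∫⁻ w in Iio z.1 ×ˢ univ ∪ {z}, ENNReal.ofReal w.2 ∂m := by
        rw [lintegral_union (measurableSet_singleton z) hd, lintegral_singleton,
          totalSize_jumpsBefore_eq_setLIntegral]
        gcongr
        exact le_mul_of_one_le_right (zero_le) hz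
    _ ≤ _ := lintegral_mono_set hsub

/-- The hypothesis `1 ≤ m {z}` says that `z` is a point of the counting measure `m`. -/
theorem firstPassage_eq_of_straddles {m : Measure (ℝ × ℝ)} {T : ℝ} {z : ℝ × ℝ}
    (hz : 1 ≤ m {z}) (hz0 : 0 ≤ z.1) (h : Straddles T m z) : firstPassage m T = z.1 := by
  refine IsLeast.csInf_eq ⟨⟨hz0, h.2.trans_le (add_le_subordinator hz)⟩, fun r hr => ?_⟩
  by_contra hlt
  exact absurd (hr.2.trans_le (subordinator_le_totalSize_jumpsBefore m (not_le.1 hlt)))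
    h.1.not_gt

theorem xi_eq_of_straddles {m : Measure (ℝ × ℝ)} {T : ℝ} {z : ℝ × ℝ}
    (hz : 1 ≤ m {z}) (hz0 : 0 ≤ z.1) (h : Straddles T m z) :
    xi T m = completion T (jumpsBefore m z.1) := by
  rw [xi, undershoot, firstPassage_eq_of_straddles hz hz0 h, leftLim_subordinator, completion,
    jumpsBefore, Measure.map_map (by fun_prop) measurable_snd]
  rfl

/-- At most one jump straddles a given level, provided that the jump times are distinct. -/
theorem lintegral_eq_zero_or_exists_straddles {m : Measure (ℝ × ℝ)} (hm : IsCountingMeasure m)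
    (hd : ∀ᵐ z ∂m, m {w | w.1 = z.1} < 2) (T : ℝ) :
    (∀ h : ℝ × ℝ → ℝ≥0∞, (∀ w, ¬ Straddles T m w → h w = 0) → ∫⁻ w, h w ∂m = 0) ∨
    ∃ z, Straddles T m z ∧ 1 ≤ m {z} ∧
      ∀ h : ℝ × ℝ → ℝ≥0∞, (∀ w, ¬ Straddles T m w → h w = 0) → ∫⁻ w, h w ∂m = h z := by
  obtain ⟨I, x, hx⟩ := hm
  have hint : ∀ h : ℝ × ℝ → ℝ≥0∞, ∫⁻ w, h w ∂m = ∑' i, h (x i) := by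
    intro h
    rw [hx, lintegral_sum_measure]
    simp only [lintegral_dirac]
  have hle : ∀ i, 1 ≤ m {x i} := by
    intro i
    rw [hx, Measure.sum_apply _ (measurableSet_singleton _)]
    refine le_trans ?_ (ENNReal.le_tsum i)
    simp
  have hd' : ∀ i, m {w | w.1 = (x i).1} < 2 := by
    intro i
    have h1 : ∀ᵐ z ∂(Measure.sum fun i => Measure.dirac (x i)), m {w | w.1 = z.1} < 2 := hx ▸ hd
    rw [Measure.ae_sum_iff] at h1
    have := h1 i
    rwa [ae_dirac_eq, Filter.eventually_pure] at this
  have hne : ∀ i j, i ≠ j → (x i).1 ≠ (x j).1 := by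
    intro i j hij heq
    refine absurd (hd' i) (not_lt.2 ?_)
    have hS : MeasurableSet {w : ℝ × ℝ | w.1 = (x i).1} :=
      measurable_fst (measurableSet_singleton _)
    rw [hx, Measure.sum_apply _ hS]
    refine le_trans ?_ (ENNReal.sum_le_tsum {i, j})
    rw [Finset.sum_pair hij, Measure.dirac_apply' _ hS, Measure.dirac_apply' _ hS,
      indicator_of_mem (by exact rfl), indicator_of_mem (by exact heq.symm)]
    norm_num
  have hlt : ∀ i j, (x i).1 < (x j).1 → Straddles T m (x i) → ¬ Straddles T m (x j) := by
    intro i j hij hi hj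
    have h1 := (add_le_subordinator (hle i)).trans (subordinator_le_totalSize_jumpsBefore m hij)
    exact absurd (hi.2.trans_le h1) hj.1.not_gt
  by_cases hex : ∃ i, Straddles T m (x i)
  · obtain ⟨i, hi⟩ := hex
    refine Or.inr ⟨x i, hi, hle i, fun h hh => ?_⟩
    rw [hint]
    refine tsum_eq_single i fun j hj => hh _ fun hj' => ?_
    rcases lt_or_gt_of_ne (hne j i hj) with h1 | h1
    · exact hlt j i h1 hj' hi
    · exact hlt i j h1 hi hj'
  · refine Or.inl fun h hh => ?_
    rw [hint]
    exact ENNReal.tsum_eq_zero.2 fun i => hh _ fun hi => hex ⟨i, hi⟩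

/-! ### The laws of the two point processes -/

section

variable {Ω : Type*} [MeasurableSpace Ω] {α K : ℝ} {N : Ω → Measure (ℝ × ℝ)} {P : Measure Ω}

theorem measurableSet_fst_eq (t : ℝ) : MeasurableSet {w : ℝ × ℝ | w.1 = t} :=
  measurable_fst (measurableSet_singleton t)

theorem exists_scaling_stableIntensity {K' : ℝ} (hα : 0 < α) (hK : 0 < K) (hK' : 0 < K') {a : ℝ}
    (ha : 0 < a) : ∃ b > 0, (stableIntensity α K).map (scaling a b) = stableIntensity α K' := by
  refine ⟨(a * K' / K) ^ α⁻¹, by positivity, ?_⟩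
  rw [map_scaling_stableIntensity _ _ ha (by positivity), Real.rpow_inv_rpow (by positivity) hα.ne']
  congr 1
  field_simp

section

variable [IsProbabilityMeasure P]

theorem measurableSet_apply_fst_eq_lt_two {γ : Type*} [MeasurableSpace γ] (ν : Measure (ℝ × ℝ))
    [SigmaFinite ν] {z : γ → ℝ × ℝ} {m : γ → Measure (ℝ × ℝ)} (hz : Measurable z)
    (hm : Measurable m) (hfin : ∀ c, IsLocallyFinite ν (m c)) :
    MeasurableSet {c | m c {w | w.1 = (z c).1} < 2} := by
  refine measurableSet_lt ?_ measurable_const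
  refine measurable_measure_of_isLocallyFinite ν hm hfin (D := {p | p.2.1 = (z p.1).1}) ?_
  exact measurableSet_eq_fun (by fun_prop) (by fun_prop)

/-- Almost surely no two jumps happen at the same time. -/
theorem ae_jump_times_distinct (hN : IsPoissonPointProcess N (stableIntensity α K) P)
    (hfin : ∀ ω, IsLocallyFinite (stableIntensity α K) (N ω)) :
    ∀ᵐ ω ∂P, ∀ᵐ z ∂(N ω), N ω {w | w.1 = z.1} < 2 := by
  set ν := stableIntensity α K with hν
  let f : ℝ × ℝ → Measure (ℝ × ℝ) → ℝ≥0∞ := fun z m => if m {w | w.1 = z.1} < 2 then 0 else 1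
  have h0 : ∫⁻ ω, ∫⁻ z, f z (N ω) ∂(N ω) ∂P = 0 := by
    rw [hN.mecke hfin (f := f) (Measurable.ite (measurableSet_apply_fst_eq_lt_two ν measurable_fst
      ((measurable_truncation ν).comp measurable_snd) fun c => isLocallyFinite_truncation ν c.2)
      measurable_const measurable_const), ← lintegral_zero (μ := ν)]
    refine lintegral_congr fun z => ?_
    rw [← lintegral_zero (μ := P)]
    refine lintegral_congr_ae ?_
    filter_upwards [hN.ae_apply_eq_zero (measurableSet_fst_eq z.1)
      (stableIntensity_singleton_prod α K z.1)] with ω hω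
    refine if_pos ?_
    rw [Measure.add_apply, hω, zero_add]
    exact prob_le_one.trans_lt ENNReal.one_lt_two
  rw [lintegral_eq_zero_iff] at h0
  · filter_upwards [h0] with ω hω
    have hω' : ∫⁻ z, f z (N ω) ∂(N ω) = 0 := hω
    have hm : Measurable fun z => f z (N ω) :=
      Measurable.ite (measurableSet_apply_fst_eq_lt_two ν measurable_id
        (measurable_const (a := N ω)) fun _ => hfin ω) measurable_const measurable_const
    rw [lintegral_eq_zero_iff hm] at hω'
    filter_upwards [hω'] with z hz
    by_contra h
    simp [f, h] at hz
  · exact measurable_lintegral_of_isLocallyFinite ν hN.measurable hfin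
      (Measurable.ite (measurableSet_apply_fst_eq_lt_two ν measurable_snd
        (hN.measurable.comp measurable_fst) fun c => hfin c.1) measurable_const measurable_const)

/-- Almost surely the level `T` is straddled by a jump: the expected number of straddling jumps is
one, and there is never more than one. -/
theorem ae_exists_straddles (hα : α ∈ Ioo (0 : ℝ) 1) (hK : 0 < K)
    (hN : IsPoissonPointProcess N (stableIntensity α K) P)
    (hfin : ∀ ω, IsLocallyFinite (stableIntensity α K) (N ω)) {T : ℝ} (hT : 0 < T) :
    ∀ᵐ ω ∂P, ∃ z, Straddles T (N ω) z ∧ xi T (N ω) = completion T (jumpsBefore (N ω) z.1) ∧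
      ∀ h : ℝ × ℝ → ℝ≥0∞, (∀ w, ¬ Straddles T (N ω) w → h w = 0) → ∫⁻ w, h w ∂(N ω) = h z := by
  set ν := stableIntensity α K with hν
  have hsupp : ∀ ω w, ¬ Straddles T (N ω) w → straddleTerm (fun _ => 1) T (N ω) w = 0 :=
    fun ω w h => straddleTerm_of_not h
  have hmeas : Measurable fun ω => ∫⁻ z, straddleTerm (fun _ => 1) T (N ω) z ∂(N ω) := by
    refine measurable_lintegral_of_isLocallyFinite ν hN.measurable hfin ?_
    exact measurable_straddleTerm ν (m := fun c : Ω × (ℝ × ℝ) => N c.1)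
      (hN.measurable.comp measurable_fst) (fun c => hfin _) measurable_const measurable_snd
      measurable_const
  have hE := lintegral_lintegral_straddleTerm hα hK hN hfin (F := fun _ => 1) measurable_const hT
  simp only [lintegral_const, measure_univ, mul_one] at hE
  have hle : ∀ᵐ ω ∂P, ∫⁻ z, straddleTerm (fun _ => 1) T (N ω) z ∂(N ω) ≤ 1 := by
    filter_upwards [hN.counting, ae_jump_times_distinct hN hfin] with ω h1 h2
    rcases lintegral_eq_zero_or_exists_straddles h1 h2 T with h | ⟨z, hz, -, h⟩
    · rw [h _ (hsupp ω)]
      exact zero_le_one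
    · rw [h _ (hsupp ω), straddleTerm, if_pos hz]
  have hone := ae_eq_of_ae_le_of_lintegral_le hle (by rw [hE]; exact ENNReal.one_ne_top)
    aemeasurable_const (by rw [hE]; simp)
  filter_upwards [hN.counting, ae_jump_times_distinct hN hfin, hone,
    hN.ae_apply_eq_zero (measurableSet_Ioi.prod measurableSet_Ioi).compl
      (stableIntensity_compl_quadrant α K)] with ω h1 h2 h3 h4
  rcases lintegral_eq_zero_or_exists_straddles h1 h2 T with h | ⟨z, hz, hz1, h⟩
  · rw [h _ (hsupp ω)] at h3
    exact absurd h3 zero_ne_one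
  · refine ⟨z, hz, xi_eq_of_straddles hz1 ?_ hz, h⟩
    by_contra hneg
    have : N ω {z} = 0 := by
      refine measure_mono_null (singleton_subset_iff.2 ?_) h4
      exact fun h' => hneg (le_of_lt h'.1)
    rw [this] at hz1
    exact absurd hz1 (by simp)

theorem ae_xi_mem_massPartitions (hα : α ∈ Ioo (0 : ℝ) 1) (hK : 0 < K)
    (hN : IsPoissonPointProcess N (stableIntensity α K) P)
    (hfin : ∀ ω, IsLocallyFinite (stableIntensity α K) (N ω)) {T : ℝ} (hT : 0 < T) :
    ∀ᵐ ω ∂P, xi T (N ω) ∈ massPartitions := by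
  filter_upwards [ae_exists_straddles hα hK hN hfin hT, hN.counting,
    hN.ae_apply_eq_zero (measurableSet_Ioi.prod measurableSet_Ioi).compl
      (stableIntensity_compl_quadrant α K)] with ω h1 h2 h3
  obtain ⟨z, hz, hxi, -⟩ := h1
  rw [hxi]
  exact completion_mem_massPartitions (h2.jumpsBefore _) (jumpsBefore_Iic h3 _) hT hz.1

theorem ae_eta_eq_selfNormalize (hN : IsPoissonPointProcess N (stableIntensity α K) P) (s : ℝ) :
    ∀ᵐ ω ∂P, eta s (N ω) = selfNormalize (jumpsBefore (N ω) s) := by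
  filter_upwards [hN.ae_apply_eq_zero (measurableSet_fst_eq s)
    (stableIntensity_singleton_prod α K s)] with ω hω
  exact eta_eq_selfNormalize hω

theorem ae_eta_mem_massPartitions (hα : α ∈ Ioo (0 : ℝ) 1) (hK : 0 < K)
    (hN : IsPoissonPointProcess N (stableIntensity α K) P)
    (hfin : ∀ ω, IsLocallyFinite (stableIntensity α K) (N ω)) {s : ℝ} (hs : 0 < s) :
    ∀ᵐ ω ∂P, eta s (N ω) ∈ massPartitions := by
  filter_upwards [ae_eta_eq_selfNormalize hN s, hN.counting,
    hN.ae_apply_eq_zero (measurableSet_Ioi.prod measurableSet_Ioi).compl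
      (stableIntensity_compl_quadrant α K), ae_totalSize_jumpsBefore_lt_top hα hK hN hfin s,
    ae_totalSize_jumpsBefore_pos hα hK hN hs] with ω h1 h2 h3 h4 h5
  rw [h1]
  exact selfNormalize_mem_massPartitions (h2.jumpsBefore _) (jumpsBefore_Iic h3 _) h5 h4

theorem aemeasurable_eta (hN : IsPoissonPointProcess N (stableIntensity α K) P)
    (hfin : ∀ ω, IsLocallyFinite (stableIntensity α K) (N ω)) (s : ℝ) :
    AEMeasurable (fun ω => eta s (N ω)) P :=
  ⟨fun ω => selfNormalize (jumpsBefore (N ω) s),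
    measurable_selfNormalize_jumpsBefore _ hN.measurable hfin measurable_const,
    ae_eta_eq_selfNormalize hN s⟩

theorem aemeasurable_xi (hα : α ∈ Ioo (0 : ℝ) 1) (hK : 0 < K)
    (hN : IsPoissonPointProcess N (stableIntensity α K) P)
    (hfin : ∀ ω, IsLocallyFinite (stableIntensity α K) (N ω)) {T : ℝ} (hT : 0 < T) :
    AEMeasurable (fun ω => xi T (N ω)) P := by
  set ν := stableIntensity α K with hν
  have hS : ∀ ω, MeasurableSet {z | Straddles T (N ω) z} := fun ω =>
    measurableSet_straddles ν (m := fun _ => N ω) measurable_const (fun _ => hfin ω)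
      measurable_const measurable_id
  have hC : ∀ ω, Measurable fun z : ℝ × ℝ => completion T (jumpsBefore (N ω) z.1) := fun ω =>
    measurable_completion_jumpsBefore ν (m := fun _ => N ω) measurable_const (fun _ => hfin ω)
      measurable_fst measurable_const
  -- averaging over the straddling jumps gives a version of `ξ(T)` that is measurable everywhere
  let g : Ω → Measure ℝ := fun ω => ((N ω).restrict {z | Straddles T (N ω) z}).bind
    fun z => completion T (jumpsBefore (N ω) z.1)
  have hg : ∀ ω (B : Set ℝ), MeasurableSet B →
      g ω B = ∫⁻ z, straddleTerm (fun j => j B) T (N ω) z ∂(N ω) := by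
    intro ω B hB
    rw [Measure.bind_apply hB (hC ω).aemeasurable, ← lintegral_indicator (hS ω)]
    refine lintegral_congr fun z => ?_
    by_cases hz : Straddles T (N ω) z
    · rw [indicator_of_mem (show z ∈ {z | Straddles T (N ω) z} from hz), straddleTerm, if_pos hz]
    · rw [indicator_of_notMem (show z ∉ {z | Straddles T (N ω) z} from hz), straddleTerm,
        if_neg hz]
  refine ⟨g, Measure.measurable_of_measurable_coe _ fun B hB => ?_, ?_⟩
  · simp only [hg _ B hB]
    refine measurable_lintegral_of_isLocallyFinite ν hN.measurable hfin ?_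
    exact measurable_straddleTerm ν (m := fun c : Ω × (ℝ × ℝ) => N c.1)
      (hN.measurable.comp measurable_fst) (fun c => hfin _) measurable_const measurable_snd
      (Measure.measurable_coe hB)
  · filter_upwards [ae_exists_straddles hα hK hN hfin hT] with ω hω
    obtain ⟨z, hz, hxi, h⟩ := hω
    ext B hB
    rw [hg ω B hB, h _ fun w hw => straddleTerm_of_not hw, straddleTerm, if_pos hz, hxi]

/-- The central identity, restated for the laws: the sum over the straddling jumps has exactly one
term. -/
theorem map_xi_eq_map_eta (hα : α ∈ Ioo (0 : ℝ) 1) (hK : 0 < K)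
    (hN : IsPoissonPointProcess N (stableIntensity α K) P)
    (hfin : ∀ ω, IsLocallyFinite (stableIntensity α K) (N ω)) {T : ℝ} (hT : 0 < T) :
    P.map (fun ω => xi T (N ω)) = P.map (fun ω => eta 1 (N ω)) := by
  refine Measure.ext_of_lintegral _ fun F hF => ?_
  rw [lintegral_map' hF.aemeasurable (aemeasurable_xi hα hK hN hfin hT),
    lintegral_map' hF.aemeasurable (aemeasurable_eta hN hfin 1)]
  have h1 : ∫⁻ ω, F (eta 1 (N ω)) ∂P = ∫⁻ ω, F (selfNormalize (jumpsBefore (N ω) 1)) ∂P :=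
    lintegral_congr_ae ((ae_eta_eq_selfNormalize hN 1).mono fun ω hω => by simp only [hω])
  rw [h1, ← lintegral_lintegral_straddleTerm hα hK hN hfin hF hT]
  refine lintegral_congr_ae ?_
  filter_upwards [ae_exists_straddles hα hK hN hfin hT] with ω hω
  obtain ⟨z, hz, hxi, h⟩ := hω
  rw [h _ fun w hw => straddleTerm_of_not hw, straddleTerm, if_pos hz, hxi]

/-- The law of `η(s)` depends neither on `s` nor on the constant in the Lévy measure. -/
theorem map_eta_eq_map_eta {Ω' : Type*} [MeasurableSpace Ω'] {K' : ℝ} {P' : Measure Ω'}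
    [IsProbabilityMeasure P'] {N' : Ω' → Measure (ℝ × ℝ)} (hα : 0 < α) (hK : 0 < K)
    (hK' : 0 < K') (hN : IsPoissonPointProcess N (stableIntensity α K) P)
    (hfin : ∀ ω, IsLocallyFinite (stableIntensity α K) (N ω))
    (hN' : IsPoissonPointProcess N' (stableIntensity α K') P')
    (hfin' : ∀ ω, IsLocallyFinite (stableIntensity α K') (N' ω)) {s : ℝ} (hs : 0 < s) :
    P.map (fun ω => eta s (N ω)) = P'.map (fun ω => eta 1 (N' ω)) := by
  refine Measure.ext_of_lintegral _ fun F hF => ?_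
  rw [lintegral_map' hF.aemeasurable (aemeasurable_eta hN hfin s),
    lintegral_map' hF.aemeasurable (aemeasurable_eta hN' hfin' 1)]
  have h1 : ∫⁻ ω, F (eta s (N ω)) ∂P = ∫⁻ ω, F (selfNormalize (jumpsBefore (N ω) s)) ∂P :=
    lintegral_congr_ae ((ae_eta_eq_selfNormalize hN s).mono fun ω hω => by simp only [hω])
  have h2 : ∫⁻ ω, F (eta 1 (N' ω)) ∂P' = ∫⁻ ω, F (selfNormalize (jumpsBefore (N' ω) 1)) ∂P' :=
    lintegral_congr_ae ((ae_eta_eq_selfNormalize hN' 1).mono fun ω hω => by simp only [hω])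
  obtain ⟨b, hb, hbν⟩ := exists_scaling_stableIntensity (α := α) (K := K) (K' := K') hα hK hK'
    (inv_pos.2 hs)
  have hN1 := hN.map (measurable_scaling s⁻¹ b)
  rw [hbν] at hN1
  set ν := stableIntensity α K' with hν
  have hG : Measurable fun m => F (selfNormalize (jumpsBefore (truncation ν m) 1)) :=
    hF.comp (measurable_selfNormalize_jumpsBefore ν (measurable_truncation ν)
      (isLocallyFinite_truncation ν) measurable_const)
  rw [h1, h2, hN'.lintegral_eq hN1 (G := fun m => F (selfNormalize (jumpsBefore m 1))) hG]
  refine lintegral_congr fun ω => ?_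
  have := jumpsBefore_map_scaling (N ω) s (inv_pos.2 hs) b
  rw [inv_mul_cancel₀ hs.ne'] at this
  rw [this, selfNormalize_map_mul _ hb]

end

theorem IsStableJumpProcess.map_scaling {K' a b : ℝ} (ha : 0 < a) (hb : 0 < b)
    (hN : IsStableJumpProcess α K N P)
    (hν : (stableIntensity α K).map (scaling a b) = stableIntensity α K') :
    IsStableJumpProcess α K' (fun ω => (N ω).map (scaling a b)) P where
  mem := by
    filter_upwards [hN.mem] with ω hω
    obtain ⟨h1, h2, h3⟩ := hω
    have hm := measurable_scaling a b
    refine ⟨h1.map hm, ?_, fun ε hε => ?_⟩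
    · rw [Measure.map_apply hm (measurableSet_Ioi.prod measurableSet_Ioi).compl]
      have hsub : scaling a b ⁻¹' (Ioi 0 ×ˢ Ioi 0)ᶜ ⊆ (Ioi 0 ×ˢ Ioi 0)ᶜ :=
        fun z hz h => hz ⟨mul_pos ha h.1, mul_pos hb h.2⟩
      exact measure_mono_null hsub h2
    · rw [Measure.map_apply hm (measurableSet_Ioo.prod measurableSet_Ioi)]
      have hε' : 0 < min (ε / b) (a * ε) := lt_min (div_pos hε hb) (mul_pos ha hε)
      refine lt_of_le_of_lt (measure_mono fun z hz => ?_) (h3 _ hε')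
      obtain ⟨⟨hz1, hz2⟩, hz3⟩ := hz
      refine ⟨⟨(mul_pos_iff_of_pos_left ha).1 hz1, ?_⟩, ?_⟩
      · have : z.1 < 1 / (a * ε) := by
          rw [lt_div_iff₀ (mul_pos ha hε)]
          have := (lt_div_iff₀ hε).1 hz2
          change a * z.1 * ε < 1 at this
          linarith
        exact this.trans_le (one_div_le_one_div_of_le hε' (min_le_right _ _))
      · change min (ε / b) (a * ε) < z.2
        refine (min_le_left _ _).trans_lt ?_
        rw [div_lt_iff₀ hb, mul_comm]
        exact hz3
  isPoisson := by
    have := hN.isPoisson.map (measurable_scaling a b)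
    rwa [hν] at this

/-- After a modification on a null set, a Poisson process is locally finite everywhere. -/
theorem IsPoissonPointProcess.exists_isLocallyFinite_version {X : Type*} [MeasurableSpace X]
    [IsProbabilityMeasure P] {ν : Measure X} [SigmaFinite ν] {N : Ω → Measure X}
    (hN : IsPoissonPointProcess N ν P) :
    ∃ N' : Ω → Measure X, IsPoissonPointProcess N' ν P ∧ (∀ ω, IsLocallyFinite ν (N' ω)) ∧
      N =ᵐ[P] N' :=
  ⟨_, hN.truncation, fun _ => isLocallyFinite_truncation ν _,
    hN.ae_isLocallyFinite.mono fun _ h => (truncation_of_isLocallyFinite h).symm⟩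

end

end PitmanYor

open PitmanYor in
theorem theorem3p1 (α : ℝ) (hα : α ∈ Set.Ioo (0 : ℝ) 1) (K T s : ℝ)
    (hK : 0 < K) (hT : 0 < T) (hs : 0 < s)
    {Ω : Type u} [MeasurableSpace Ω] (P : Measure Ω) [IsProbabilityMeasure P]
    (N : Ω → Measure (ℝ × ℝ)) (hN : PitmanYor.IsStableJumpProcess α K N P) :
    (∀ᵐ ω ∂P, PitmanYor.xi T (N ω) ∈ PitmanYor.massPartitions) ∧
    (∀ᵐ ω ∂P, PitmanYor.eta s (N ω) ∈ PitmanYor.massPartitions) ∧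
    (∃ Q : Measure (Measure ℝ), PitmanYor.IsStandardPitmanYorLaw.{u} α Q) ∧
    (∀ Q : Measure (Measure ℝ), PitmanYor.IsStandardPitmanYorLaw.{u} α Q →
      HasLaw (fun ω => PitmanYor.xi T (N ω)) Q P ∧
      HasLaw (fun ω => PitmanYor.eta s (N ω)) Q P) ∧
    IdentDistrib (fun ω => PitmanYor.xi T (N ω)) (fun ω => PitmanYor.eta s (N ω)) P P := by
  obtain ⟨N', hN', hfin, hNN'⟩ := hN.isPoisson.exists_isLocallyFinite_version
  have hxi : (fun ω => xi T (N ω)) =ᵐ[P] fun ω => xi T (N' ω) :=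
    hNN'.mono fun ω h => by simp only [h]
  have heta : (fun ω => eta s (N ω)) =ᵐ[P] fun ω => eta s (N' ω) :=
    hNN'.mono fun ω h => by simp only [h]
  have hxim := aemeasurable_xi hα hK hN' hfin hT
  have hetam := aemeasurable_eta hN' hfin s
  have hlaw : P.map (fun ω => xi T (N' ω)) = P.map (fun ω => eta s (N' ω)) := by
    rw [map_xi_eq_map_eta hα hK hN' hfin hT,
      ← map_eta_eq_map_eta hα.1 hK hK hN' hfin hN' hfin hs]
  have hΓ : 0 < 1 / Real.Gamma (1 - α) :=
    one_div_pos.2 (Real.Gamma_pos_of_pos (by linarith [hα.2]))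
  refine ⟨?_, ?_, ?_, ?_, ?_⟩
  · filter_upwards [hxi, ae_xi_mem_massPartitions hα hK hN' hfin hT] with ω h1 h2
    rwa [h1]
  · filter_upwards [heta, ae_eta_mem_massPartitions hα hK hN' hfin hs] with ω h1 h2
    rwa [h1]
  · -- rescaling the given jump sizes produces a process with the standard constant
    obtain ⟨b, hb, hbν⟩ := exists_scaling_stableIntensity (K := K) hα.1 hK hΓ one_pos
    have h0 := hN.map_scaling one_pos hb hbν
    obtain ⟨N₀, hN₀, hfin₀, hNN₀⟩ := h0.isPoisson.exists_isLocallyFinite_version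
    refine ⟨_, Ω, _, P, _, inferInstance, h0, ?_, rfl⟩
    exact (aemeasurable_eta hN₀ hfin₀ 1).congr (hNN₀.symm.mono fun ω h => by simp only [h])
  · rintro Q ⟨Ω₀, _, P₀, M, _, hM, hQ⟩
    obtain ⟨M', hM', hfinM, hMM'⟩ := hM.isPoisson.exists_isLocallyFinite_version
    have hQ' : P.map (fun ω => eta s (N' ω)) = Q := by
      rw [map_eta_eq_map_eta hα.1 hK hΓ hN' hfin hM' hfinM hs, ← hQ.map_eq]
      exact Measure.map_congr (hMM'.symm.mono fun ω h => by simp only [h])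
    exact ⟨HasLaw.congr ⟨hxim, hlaw.trans hQ'⟩ hxi, HasLaw.congr ⟨hetam, hQ'⟩ heta⟩
  · exact ⟨hxim.congr hxi.symm, hetam.congr heta.symm,
      (Measure.map_congr hxi).trans (hlaw.trans (Measure.map_congr heta).symm)⟩
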